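/- **Setting.** Let $l_1,\dots,l_4$ be one-dimensional subspaces spanning $\mathbb{R}^4$. The hyperplanes spanned by triples of them split $\mathbb{R}^4$ into a set $\mathcal{C}(l_1,\dots,l_4)$ of $16$ simplicial cones. The *sail* of such a cone $C$ is the boundary of $\mathrm{conv}(C\cap\mathbb{Z}^4\setminus\{0\})$, and $\mathrm{CF}(l_1,\dots,l_4)$ is the union of the $16$ sails. It is *algebraic* if $l_1,\dots,l_4$ are the eigenspaces of an operator $A\in\mathrm{GL}_4(\mathbb{Z})$ all of whose eigenvalues are real and whose characteristic polynomial is irreducible over $\mathbb{Q}$. A *symmetry* is an operator $G\in\mathrm{GL}_4(\mathbb{Z})$ with $G(\mathrm{CF}(l_1,\dots,l_4))=\mathrm{CF}(l_1,\dots,l_4)$; it is *palindromic* if $G(l_i)\neq l_i$ for some $i$, and a palindromic symmetry is *proper* if $G$ has a fixed point on one of the sails. For $v,w\in\mathbb{R}^4$ write $v\sim w$ if $Xv=\mu w$ for some $X\in\mathrm{GL}_4(\mathbb{Z})$ and some nonzero $\mu\in\mathbb{R}$. **Theorem.** Let $\mathrm{CF}(l_1,l_2,l_3,l_4)$ be algebraic,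 let $l_1$ be spanned by $(1,\alpha,\beta,\gamma)$ and let $K=\mathbb{Q}(\alpha,\beta,\gamma)$. Then $\mathrm{CF}(l_1,l_2,l_3,l_4)$ has a proper palindromic symmetry if and only if all the embeddings of $K$ into $\mathbb{R}$ can be numbered $\sigma_1=\mathrm{id},\sigma_2,\sigma_3,\sigma_4$ (there being exactly four of them) in such a way that $$\sigma_3(K)=K,\quad \sigma_4(K)=\sigma_2(K),\quad \sigma_3^2=\mathrm{id},\quad \sigma_4=\sigma_2\sigma_3,$$ and there exist $\omega,\psi\in K$, both algebraic of degree $4$ over $\mathbb{Q}$, such that with $\omega'=\sigma_3(\omega)$ and $\psi'=\sigma_3(\psi)$ at least one of the following conditions holds: 1. $(1,\alpha,\beta,\gamma)\sim(1,\omega,\psi,\omega')$ and $\psi+\psi'=-(\omega+\omega')$; 2. $(1,\alpha,\beta,\gamma)\sim(1,\omega,\psi,\omega')$ and $\psi+\psi'=1-(\omega+\omega')$; 3. $(1,\alpha,\beta,\gamma)\sim(1,\omega,\psi,\omega')$ and $\psi+\psi'=2-(\omega+\omega')$; 4. $(1,\alpha,\beta,\gamma)\sim(1,\omega,\psi,\frac{\omega+\omega'}{2})$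 and $\psi+\psi'=-(\omega+\omega')$; 5. $(1,\alpha,\beta,\gamma)\sim(1,\omega,\psi,\frac{\omega+\omega'}{2})$ and $\psi+\psi'=2-(\omega+\omega')$; 6. $(1,\alpha,\beta,\gamma)\sim(1,\omega,\psi,\frac{\omega+\omega'+1}{2})$ and $\psi+\psi'=-(\omega+\omega')$; 7. $(1,\alpha,\beta,\gamma)\sim(1,\omega,\psi,\frac{\omega+\omega'+1}{2})$ and $\psi+\psi'=2-(\omega+\omega')$; 8. $(1,\alpha,\beta,\gamma)\sim(1,\omega,\psi,\frac{\omega+\omega'}{2})$ and $\psi+\psi'=1-\frac{\omega+\omega'}{2}$; 9. $(1,\alpha,\beta,\gamma)\sim(1,\omega,\psi,\frac{\omega+\omega'}{2})$ and $\psi+\psi'=2-\frac{\omega+\omega'}{2}$; 10. $(1,\alpha,\beta,\gamma)\sim(1,\omega,\psi,\frac{\omega'-\omega}{4})$ and $\psi+\psi'=2-\frac{\omega+\omega'}{2}$. -/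

import Mathlib

open scoped MatrixGroups

namespace KleinPolyhedra

/-- The linear operator on `ℝⁿ` given by an integer matrix. -/
noncomputable def realOp {n : ℕ} (G : GL (Fin n) ℤ) : (Fin n → ℝ) →ₗ[ℝ] (Fin n → ℝ) :=
  Matrix.toLin' ((G : Matrix (Fin n) (Fin n) ℤ).map (Int.cast : ℤ → ℝ))

/-- The lattice `ℤⁿ` of integer points of `ℝⁿ`. -/
def intPoints (n : ℕ) : Set (Fin n → ℝ) :=
  {x | ∃ z : Fin n → ℤ, ∀ i, x i = z i}

/-- The simplicial cones into which `ℝⁿ` is split by the hyperplanes spanned by `n - 1` of the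
lines `l i`: each of them is spanned by a choice of one of the two rays of every line. -/
def cones {n : ℕ} (l : Fin n → Submodule ℝ (Fin n → ℝ)) : Set (Set (Fin n → ℝ)) :=
  {C | ∃ v : Fin n → (Fin n → ℝ), (∀ i, v i ∈ l i ∧ v i ≠ 0) ∧
    C = {x | ∃ c : Fin n → ℝ, (∀ i, 0 ≤ c i) ∧ x = ∑ i, c i • v i}}

/-- The Klein polyhedron of a cone: the convex hull of its nonzero integer points. -/
def kleinPolyhedron {n : ℕ} (C : Set (Fin n → ℝ)) : Set (Fin n → ℝ) :=
  convexHull ℝ ((C ∩ intPoints n) \ {0})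

/-- The Klein sail of a cone: the boundary of its Klein polyhedron. -/
def sail {n : ℕ} (C : Set (Fin n → ℝ)) : Set (Fin n → ℝ) :=
  frontier (kleinPolyhedron C)

/-- The geometric continued fraction `CF(l₁, …, lₙ)`: the union of all the sails. -/
def CF {n : ℕ} (l : Fin n → Submodule ℝ (Fin n → ℝ)) : Set (Fin n → ℝ) :=
  ⋃ C ∈ cones l, sail C

/-- Hyperbolic operators in `GLₙ(ℤ)`: all eigenvalues are real and the characteristic polynomial
is irreducible over `ℚ`. -/
def IsHyperbolic {n : ℕ} (A : GL (Fin n) ℤ) : Prop :=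
  ((A : Matrix (Fin n) (Fin n) ℤ).map (Int.cast : ℤ → ℝ)).charpoly.Splits ∧
    Irreducible ((A : Matrix (Fin n) (Fin n) ℤ).map (Int.cast : ℤ → ℚ)).charpoly

/-- `CF(l₁, …, lₙ)` is algebraic: `l₁, …, lₙ` are the eigenspaces of a hyperbolic operator,
belonging to its `n` (pairwise distinct) eigenvalues. -/
def IsAlgebraic {n : ℕ} (l : Fin n → Submodule ℝ (Fin n → ℝ)) : Prop :=
  ∃ A : GL (Fin n) ℤ, IsHyperbolic A ∧ ∃ t : Fin n → ℝ, Function.Injective t ∧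
    ∀ i, Module.End.HasEigenvalue (realOp A) (t i) ∧ l i = Module.End.eigenspace (realOp A) (t i)

/-- `G` belongs to the symmetry group of the continued fraction. -/
def IsSymmetry {n : ℕ} (l : Fin n → Submodule ℝ (Fin n → ℝ)) (G : GL (Fin n) ℤ) : Prop :=
  realOp G '' CF l = CF l

/-- Dirichlet symmetries: those inducing the identity permutation of the lines. -/
def IsDirichletSymmetry {n : ℕ} (l : Fin n → Submodule ℝ (Fin n → ℝ)) (G : GL (Fin n) ℤ) : Prop :=
  IsSymmetry l G ∧ ∀ i, (l i).map (realOp G) = l i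

/-- Palindromic symmetries: those that are not Dirichlet symmetries. -/
def IsPalindromicSymmetry {n : ℕ} (l : Fin n → Submodule ℝ (Fin n → ℝ)) (G : GL (Fin n) ℤ) :
    Prop :=
  IsSymmetry l G ∧ ¬ IsDirichletSymmetry l G

/-- Proper palindromic symmetries: those with a fixed point on some sail. -/
def IsProperPalindromicSymmetry {n : ℕ} (l : Fin n → Submodule ℝ (Fin n → ℝ))
    (G : GL (Fin n) ℤ) : Prop :=
  IsPalindromicSymmetry l G ∧ ∃ C ∈ cones l, ∃ x ∈ sail C, realOp G x = x

/-- The relation `v ∼ w`: some `X ∈ GLₙ(ℤ)` takes `v` to a nonzero real multiple of `w`. -/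
def IntEquivalent {n : ℕ} (v w : Fin n → ℝ) : Prop :=
  ∃ X : GL (Fin n) ℤ, ∃ μ : ℝ, μ ≠ 0 ∧ realOp X v = μ • w

end KleinPolyhedra

/-! An algebraic continued fraction is governed by the field `K`. The eigenvalue belonging to
`l 0` generates `K`, the lines are spanned by the conjugates of the vector `v = (1, α, β, γ)`, and
the coordinates of `v` form a `ℚ`-basis of `K` (`IsAlgebraic.nonempty_eigenFrame`).

*From symmetries to the field.* The product of the four coordinates along the lines is bounded away
from zero on the nonzero integer points (`exists_pos_le_normForm`). As superlevel sets of such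
products are convex, the sails stay away from the coordinate hyperplanes, and the rays through the
continued fraction fill exactly the complement of these hyperplanes. A symmetry therefore permutes
the hyperplanes and hence the lines (`IsSymmetry.exists_perm`). If `G` maps `l 0` to another line,
then that line is spanned by a vector over `K` as well, so that `G v = μ τ(v)` with `μ ∈ K` and an
automorphism `τ` of `K`; conjugating this equation shows that the permutation of the lines is the
free one induced by `τ` (`EigenFrame.exists_algHom`, `EigenFrame.perm_apply_ne`). A fixed point on a
sail has no vanishing coordinate, which forces `G` or `G ^ 2` to be an involution
(`IsProperPalindromicSymmetry.exists_involution`). Conversely, an involution permuting the lines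
freely has generic fixed vectors, and the ray through one of them meets a sail.

*Lattices.* A proper palindromic symmetry thus amounts to an involution `H` in `GL₄(ℤ)` with
`H v = μ τ(v)`. Its trace is zero, and up to conjugation there are at most three such
integer involutions (`intConj_of_involution`). In suitable coordinates each of them fixes the first
basis vector; dividing by the corresponding element of `K` turns the lattice spanned by the coordinates of
`v` into a `τ`-invariant one with a basis `1, ω, ψ, …` on which `τ` acts by an explicit matrix
(`EigenFrame.exists_basis_of_intConj`). The three matrices give the first, the second and the fourth
of the ten conditions, and `ω`, `ψ` have degree four because they are
moved by `τ` and their traces `ω + τ ω`, `ψ + τ ψ` are not rational (`natDegree_minpoly_eq_four`).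
Conversely, in each of the ten conditions `τ` acts on the lattice basis by an integer involution, which is transported to a
symmetry (`EigenFrame.exists_isProperPalindromicSymmetry`). -/

namespace KleinPolyhedra

/-! ### Cones and sails in coordinates along the lines -/

section Geometry

variable {n : ℕ}

/-- The product of the coordinates of `x` in the basis `b`; when the vectors of `b` span the lines
of an algebraic continued fraction this is, up to a constant, the norm form of a number field. -/
noncomputable def normForm (b : Module.Basis (Fin n) ℝ (Fin n → ℝ)) (x : Fin n → ℝ) : ℝ :=
  ∏ i, b.repr x i

/-- The closed simplicial cone spanned by the vectors `a i • b i` (all `a i` being nonzero),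
described by the signs of the coordinates. -/
def signCone (b : Module.Basis (Fin n) ℝ (Fin n → ℝ)) (a : Fin n → ℝ) : Set (Fin n → ℝ) :=
  {x | ∀ i, 0 ≤ a i * b.repr x i}

theorem mem_cones_iff (b : Module.Basis (Fin n) ℝ (Fin n → ℝ))
    {l : Fin n → Submodule ℝ (Fin n → ℝ)} (hl : ∀ i, l i = Submodule.span ℝ {b i})
    {C : Set (Fin n → ℝ)} :
    C ∈ cones l ↔ ∃ a : Fin n → ℝ, (∀ i, a i ≠ 0) ∧ C = signCone b a := by
  have key : ∀ a : Fin n → ℝ, (∀ i, a i ≠ 0) →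
      {x | ∃ c : Fin n → ℝ, (∀ i, 0 ≤ c i) ∧ x = ∑ i, c i • (a i • b i)} = signCone b a := by
    intro a ha
    ext x
    simp only [Set.mem_ofPred_eq, signCone]
    constructor
    · rintro ⟨c, hc, rfl⟩ i
      have : (∑ i, c i • (a i • b i)) = ∑ i, (c i * a i) • b i := by simp [smul_smul]
      rw [this, b.repr_sum_self]
      nlinarith [hc i, mul_nonneg (hc i) (mul_self_nonneg (a i))]
    · intro h
      refine ⟨fun i => b.repr x i / a i, fun i => ?_, ?_⟩
      · have : b.repr x i / a i = (a i * b.repr x i) / (a i * a i) := by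
          have := ha i
          field_simp
        change 0 ≤ b.repr x i / a i
        rw [this]
        exact div_nonneg (h i) (mul_self_nonneg _)
      · conv_lhs => rw [← b.sum_repr x]
        refine Finset.sum_congr rfl fun i _ => ?_
        rw [smul_smul, div_mul_cancel₀ _ (ha i)]
  constructor
  · rintro ⟨v, hv, rfl⟩
    have : ∀ i, ∃ a : ℝ, a • b i = v i := fun i => by
      have := (hv i).1
      rwa [hl, Submodule.mem_span_singleton] at this
    choose a ha using this
    have ha0 : ∀ i, a i ≠ 0 := fun i h0 => (hv i).2 (by rw [← ha i, h0, zero_smul])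
    refine ⟨a, ha0, ?_⟩
    rw [← key a ha0]
    simp only [ha]
  · rintro ⟨a, ha, rfl⟩
    refine ⟨fun i => a i • b i, fun i => ⟨?_, smul_ne_zero (ha i) (b.ne_zero i)⟩, (key a ha).symm⟩
    rw [hl]
    exact Submodule.smul_mem _ _ (Submodule.mem_span_singleton_self _)

theorem continuous_repr (b : Module.Basis (Fin n) ℝ (Fin n → ℝ)) (i : Fin n) :
    Continuous fun x => b.repr x i :=
  (b.coord i).continuous_of_finiteDimensional

theorem continuous_normForm (b : Module.Basis (Fin n) ℝ (Fin n → ℝ)) :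
    Continuous (normForm b) :=
  continuous_finsetProd _ fun i _ => continuous_repr b i

/-- Superlevel sets of the product of coordinates are convex in the open positive orthant, by
concavity of the logarithm. -/
theorem convex_setOf_le_prod {δ : ℝ} (hδ : 0 < δ) :
    Convex ℝ {y : Fin n → ℝ | (∀ i, 0 < y i) ∧ δ ≤ ∏ i, y i} := by
  have h1 : {y : Fin n → ℝ | (∀ i, 0 < y i) ∧ δ ≤ ∏ i, y i} =
      {y : Fin n → ℝ | y ∈ {y : Fin n → ℝ | ∀ i, 0 < y i} ∧
        Real.log δ ≤ ∑ i, Real.log (y i)} := by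
    ext y
    simp only [Set.mem_ofPred_eq]
    refine and_congr_right fun hy => ?_
    rw [← Real.log_prod fun i _ => (hy i).ne',
      Real.log_le_log_iff hδ (Finset.prod_pos fun i _ => hy i)]
  rw [h1]
  have hc : Convex ℝ {y : Fin n → ℝ | ∀ i, 0 < y i} := by
    intro x hx y hy s t hs ht hst i
    simp only [Pi.add_apply, Pi.smul_apply]
    exact (convex_Ioi (0 : ℝ)) (hx i) (hy i) hs ht hst
  refine ConcaveOn.convex_ge ⟨hc, ?_⟩ (Real.log δ)
  intro x hx y hy s t hs ht hst
  simp only [smul_eq_mul, Finset.mul_sum, ← Finset.sum_add_distrib]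
  refine Finset.sum_le_sum fun i _ => ?_
  exact strictConcaveOn_log_Ioi.concaveOn.2 (hx i) (hy i) hs ht hst

theorem le_abs_normForm_of_mem_closure (b : Module.Basis (Fin n) ℝ (Fin n → ℝ)) {δ : ℝ}
    (hδ : 0 < δ) (hb : ∀ x ∈ intPoints n, x ≠ 0 → δ ≤ |normForm b x|) {a : Fin n → ℝ}
    (ha : ∀ i, a i ≠ 0) {x : Fin n → ℝ} (hx : x ∈ closure (kleinPolyhedron (signCone b a))) :
    δ ≤ |normForm b x| := by
  have hprod : ∀ x, ∏ i, (a i * b.repr x i) = (∏ i, a i) * normForm b x := fun x => by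
    rw [Finset.prod_mul_distrib, normForm]
  have hA : 0 < |∏ i, a i| := abs_pos.2 (Finset.prod_ne_zero_iff.2 fun i _ => ha i)
  let f : (Fin n → ℝ) →ₗ[ℝ] (Fin n → ℝ) := LinearMap.pi fun i => a i • b.coord i
  have hf : ∀ x i, f x i = a i * b.repr x i := fun x i => by simp [f]
  have hconv := (convex_setOf_le_prod (n := n) (mul_pos hA hδ)).linear_preimage f
  have hsub : kleinPolyhedron (signCone b a) ⊆ {x | δ ≤ |normForm b x|} := by
    refine (convexHull_min ?_ hconv).trans ?_
    · rintro y ⟨⟨hyC, hyi⟩, hy0⟩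
      have hN := hb y hyi hy0
      have hN0 : normForm b y ≠ 0 := fun h => by
        rw [h, abs_zero] at hN; exact absurd hN (not_le.2 hδ)
      have hpos : ∀ i, 0 < a i * b.repr y i := fun i =>
        lt_of_le_of_ne (hyC i) (mul_ne_zero (ha i) fun h =>
          hN0 (Finset.prod_eq_zero (Finset.mem_univ i) h)).symm
      simp only [Set.mem_preimage, Set.mem_ofPred_eq, hf]
      refine ⟨hpos, ?_⟩
      rw [← abs_of_pos (Finset.prod_pos fun i _ => hpos i), hprod, abs_mul]
      exact mul_le_mul_of_nonneg_left hN hA.le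
    · rintro y ⟨hpos, hy⟩
      simp only [hf] at hpos hy
      rw [← abs_of_pos (Finset.prod_pos fun i _ => hpos i), hprod, abs_mul] at hy
      exact le_of_mul_le_mul_left hy hA
  exact closure_minimal hsub
    (isClosed_le continuous_const (continuous_normForm b).abs) hx

/-- Every point lies in the convex hull of the vertices of the integer unit cube around it. -/
theorem mem_convexHull_intPoints (y : Fin n → ℝ) :
    y ∈ convexHull ℝ {z | z ∈ intPoints n ∧ ∀ i, |z i - y i| ≤ 1} := by
  have h : y ∈ convexHull ℝ (Set.univ.pi fun i => ({(⌊y i⌋ : ℝ), (⌊y i⌋ : ℝ) + 1} : Set ℝ)) := by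
    rw [convexHull_pi]
    intro i _
    change y i ∈ convexHull ℝ _
    rw [convexHull_pair, segment_eq_Icc (by linarith)]
    exact ⟨Int.floor_le _, (Int.lt_floor_add_one _).le⟩
  refine convexHull_mono ?_ h
  intro z hz
  have hz' : ∀ i, z i = ⌊y i⌋ ∨ z i = (⌊y i⌋ : ℝ) + 1 := fun i => hz i trivial
  refine ⟨?_, fun i => ?_⟩
  · have : ∀ i, ∃ m : ℤ, z i = m := fun i => by
      rcases hz' i with h | h
      · exact ⟨_, h⟩
      · exact ⟨⌊y i⌋ + 1, by rw [h]; push_cast; rfl⟩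
    choose m hm using this
    exact ⟨m, hm⟩
  · have h1 := Int.floor_le (y i)
    have h2 := Int.lt_floor_add_one (y i)
    rw [abs_le]
    rcases hz' i with h | h <;> constructor <;> linarith

/-- The ray through an interior point of a cone meets the Klein polyhedron: far enough along the
ray, the unit cube around the point is contained in the cone. -/
theorem exists_smul_mem_kleinPolyhedron [NeZero n] (b : Module.Basis (Fin n) ℝ (Fin n → ℝ))
    {a x : Fin n → ℝ} (hx : ∀ i, 0 < a i * b.repr x i) :
    ∃ s : ℝ, 0 < s ∧ s • x ∈ kleinPolyhedron (signCone b a) := by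
  have hU : IsOpen {y : Fin n → ℝ | ∀ i, 0 < a i * b.repr y i} := by
    simp only [Set.ofPred_forall]
    exact isOpen_iInter_of_finite fun i =>
      isOpen_lt continuous_const (continuous_const.mul (continuous_repr b i))
  obtain ⟨ε, hε, hball⟩ := Metric.isOpen_iff.1 hU x hx
  refine ⟨2 / ε, by positivity, convexHull_mono ?_ (mem_convexHull_intPoints _)⟩
  rintro z ⟨hzi, hz⟩
  have hmem : (ε / 2) • z ∈ Metric.ball x ε := by
    rw [Metric.mem_ball, dist_pi_lt_iff hε]
    intro i
    rw [Real.dist_eq]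
    have : ((ε / 2) • z) i - x i = (ε / 2) * (z i - ((2 / ε) • x) i) := by
      simp only [Pi.smul_apply, smul_eq_mul]
      field_simp
    rw [this, abs_mul, abs_of_pos (by positivity)]
    nlinarith [hz i]
  have hpos : ∀ i, 0 < a i * b.repr z i := fun i => by
    have h := hball hmem i
    simp only [map_smul, Finsupp.smul_apply, smul_eq_mul] at h
    have h2 : 0 < (ε / 2) * (a i * b.repr z i) := by linarith
    exact (mul_pos_iff_of_pos_left (by positivity)).1 h2
  refine ⟨⟨fun i => (hpos i).le, hzi⟩, ?_⟩
  rintro (rfl : z = 0)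
  simpa using hpos 0

theorem normForm_zero [NeZero n] (b : Module.Basis (Fin n) ℝ (Fin n → ℝ)) : normForm b 0 = 0 :=
  Finset.prod_eq_zero (Finset.mem_univ 0) (by simp)

theorem normForm_smul (b : Module.Basis (Fin n) ℝ (Fin n → ℝ)) (s : ℝ) (x : Fin n → ℝ) :
    normForm b (s • x) = s ^ n * normForm b x := by
  simp [normForm, Finset.prod_mul_distrib]

theorem normForm_ne_zero_iff {b : Module.Basis (Fin n) ℝ (Fin n → ℝ)} {x : Fin n → ℝ} :
    normForm b x ≠ 0 ↔ ∀ i, b.repr x i ≠ 0 := by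
  simp [normForm, Finset.prod_ne_zero_iff]

/-- The ray through an interior point of a cone meets its sail, since the origin is outside the
closure of the Klein polyhedron. -/
theorem exists_smul_mem_sail [NeZero n] (b : Module.Basis (Fin n) ℝ (Fin n → ℝ)) {δ : ℝ}
    (hδ : 0 < δ) (hb : ∀ x ∈ intPoints n, x ≠ 0 → δ ≤ |normForm b x|) {a x : Fin n → ℝ}
    (hx : ∀ i, 0 < a i * b.repr x i) :
    ∃ s : ℝ, 0 < s ∧ s • x ∈ sail (signCone b a) := by
  obtain ⟨s, hs, hsx⟩ := exists_smul_mem_kleinPolyhedron b hx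
  have ha : ∀ i, a i ≠ 0 := fun i h => by simpa [h] using hx i
  set P := kleinPolyhedron (signCone b a)
  have h0 : (0 : Fin n → ℝ) ∉ closure P := fun h => by
    have := le_abs_normForm_of_mem_closure b hδ hb ha h
    rw [normForm_zero, abs_zero] at this
    exact absurd this (not_le.2 hδ)
  obtain ⟨y, hyseg, hy⟩ : (segment ℝ (0 : Fin n → ℝ) (s • x) ∩ frontier P).Nonempty := by
    by_contra hne
    have hcov : segment ℝ (0 : Fin n → ℝ) (s • x) ⊆ interior P ∪ (closure P)ᶜ := by
      intro y hy
      by_contra hy'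
      simp only [Set.mem_union, Set.mem_compl_iff, not_or, not_not] at hy'
      exact hne ⟨y, hy, hy'.2, hy'.1⟩
    have hsx' : s • x ∈ interior P := by
      rcases hcov (right_mem_segment ℝ _ _) with h | h
      · exact h
      · exact absurd (subset_closure hsx) h
    obtain ⟨y, -, hy1, hy2⟩ := (convex_segment (𝕜 := ℝ) (0 : Fin n → ℝ) (s • x)).isPreconnected
      _ _ isOpen_interior isClosed_closure.isOpen_compl hcov
      ⟨_, right_mem_segment ℝ _ _, hsx'⟩ ⟨_, left_mem_segment ℝ _ _, h0⟩
    exact hy2 (subset_closure (interior_subset hy1))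
  obtain ⟨p, q, hp, hq, -, rfl⟩ := hyseg
  rw [smul_zero, zero_add] at hy
  rcases hq.eq_or_lt with rfl | hq
  · rw [zero_smul] at hy
    exact absurd hy.1 h0
  · exact ⟨q * s, mul_pos hq hs, by rwa [mul_smul]⟩

/-- The rays through the points of the continued fraction fill exactly the complement of the
coordinate hyperplanes. -/
theorem normForm_ne_zero_iff_exists_smul_mem_CF [NeZero n]
    (b : Module.Basis (Fin n) ℝ (Fin n → ℝ))
    {l : Fin n → Submodule ℝ (Fin n → ℝ)} (hl : ∀ i, l i = Submodule.span ℝ {b i}) {δ : ℝ}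
    (hδ : 0 < δ) (hb : ∀ x ∈ intPoints n, x ≠ 0 → δ ≤ |normForm b x|) {x : Fin n → ℝ} :
    normForm b x ≠ 0 ↔ ∃ s : ℝ, 0 < s ∧ s • x ∈ CF l := by
  constructor
  · intro hx
    rw [normForm_ne_zero_iff] at hx
    obtain ⟨s, hs, hsx⟩ := exists_smul_mem_sail b hδ hb (a := fun i => b.repr x i) (x := x)
      fun i => mul_self_pos.2 (hx i)
    exact ⟨s, hs, Set.mem_biUnion ((mem_cones_iff b hl).2 ⟨_, hx, rfl⟩) hsx⟩
  · rintro ⟨s, hs, hsx⟩ h0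
    obtain ⟨C, hC, hsx⟩ := Set.mem_iUnion₂.1 hsx
    obtain ⟨a, ha, rfl⟩ := (mem_cones_iff b hl).1 hC
    have := le_abs_normForm_of_mem_closure b hδ hb ha hsx.1
    rw [normForm_smul, h0, mul_zero, abs_zero] at this
    exact absurd this (not_le.2 hδ)

theorem repr_ne_zero_of_mem_sail (b : Module.Basis (Fin n) ℝ (Fin n → ℝ))
    {l : Fin n → Submodule ℝ (Fin n → ℝ)} (hl : ∀ i, l i = Submodule.span ℝ {b i}) {δ : ℝ}
    (hδ : 0 < δ) (hb : ∀ x ∈ intPoints n, x ≠ 0 → δ ≤ |normForm b x|) {C : Set (Fin n → ℝ)}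
    (hC : C ∈ cones l) {x : Fin n → ℝ} (hx : x ∈ sail C) (i : Fin n) : b.repr x i ≠ 0 := by
  obtain ⟨a, ha, rfl⟩ := (mem_cones_iff b hl).1 hC
  have := le_abs_normForm_of_mem_closure b hδ hb ha hx.1
  refine normForm_ne_zero_iff.1 (fun h => ?_) i
  rw [h, abs_zero] at this
  exact absurd this (not_le.2 hδ)

/-! ### Symmetries and permutations of the lines -/

theorem realOp_mul (G H : GL (Fin n) ℤ) (x : Fin n → ℝ) :
    realOp (G * H) x = realOp G (realOp H x) := by
  simp only [realOp, Units.val_mul]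
  rw [show ((G : Matrix (Fin n) (Fin n) ℤ) * (H : Matrix (Fin n) (Fin n) ℤ)).map
    (Int.cast : ℤ → ℝ) = (G : Matrix (Fin n) (Fin n) ℤ).map (Int.cast : ℤ → ℝ) *
      (H : Matrix (Fin n) (Fin n) ℤ).map (Int.cast : ℤ → ℝ) from
    Matrix.map_mul (f := Int.castRingHom ℝ), Matrix.toLin'_mul, LinearMap.comp_apply]

theorem realOp_one (x : Fin n → ℝ) : realOp (1 : GL (Fin n) ℤ) x = x := by
  simp [realOp, Matrix.map_one]

theorem realOp_apply (G : GL (Fin n) ℤ) (x : Fin n → ℝ) (i : Fin n) :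
    realOp G x i = ∑ j, ((G : Matrix (Fin n) (Fin n) ℤ) i j : ℝ) * x j := by
  simp [realOp, Matrix.mulVec, dotProduct]

theorem realOp_inv_apply (G : GL (Fin n) ℤ) (x : Fin n → ℝ) : realOp G⁻¹ (realOp G x) = x := by
  rw [← realOp_mul, inv_mul_cancel, realOp_one]

theorem realOp_apply_inv (G : GL (Fin n) ℤ) (x : Fin n → ℝ) : realOp G (realOp G⁻¹ x) = x := by
  rw [← realOp_mul, mul_inv_cancel, realOp_one]

/-- The linear automorphism of `ℝⁿ` given by an element of `GLₙ(ℤ)`. -/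
noncomputable def realEquiv (G : GL (Fin n) ℤ) : (Fin n → ℝ) ≃ₗ[ℝ] (Fin n → ℝ) :=
  LinearEquiv.ofLinearMap (realOp G) (realOp G⁻¹)
    (LinearMap.ext fun x => realOp_apply_inv G x) (LinearMap.ext fun x => realOp_inv_apply G x)

theorem realOp_mem_intPoints (G : GL (Fin n) ℤ) {x : Fin n → ℝ} (hx : x ∈ intPoints n) :
    realOp G x ∈ intPoints n := by
  obtain ⟨z, hz⟩ := hx
  refine ⟨(G : Matrix (Fin n) (Fin n) ℤ).mulVec z, fun i => ?_⟩
  rw [realOp_apply]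
  simp [Matrix.mulVec, dotProduct, hz]

theorem realOp_image_sail (G : GL (Fin n) ℤ) (C : Set (Fin n → ℝ)) :
    realOp G '' sail C = sail (realOp G '' C) := by
  have h1 : realOp G '' ((C ∩ intPoints n) \ {0}) = ((realOp G '' C) ∩ intPoints n) \ {0} := by
    ext y
    constructor
    · rintro ⟨x, ⟨⟨hC, hi⟩, h0⟩, rfl⟩
      refine ⟨⟨⟨x, hC, rfl⟩, realOp_mem_intPoints G hi⟩, fun h => h0 ?_⟩
      exact (realEquiv G).map_eq_zero_iff.1 h
    · rintro ⟨⟨⟨x, hC, rfl⟩, hi⟩, h0⟩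
      refine ⟨x, ⟨⟨hC, ?_⟩, ?_⟩, rfl⟩
      · simpa [realOp_inv_apply] using realOp_mem_intPoints G⁻¹ hi
      · rintro (rfl : x = 0)
        exact h0 (map_zero _)
  have h2 := (realEquiv G).toContinuousLinearEquiv.toHomeomorph.image_frontier
    (kleinPolyhedron C)
  have h3 : ⇑(realEquiv G).toContinuousLinearEquiv.toHomeomorph = ⇑(realOp G) := rfl
  rw [h3] at h2
  rw [sail, h2, kleinPolyhedron, LinearMap.image_convexHull, h1]
  rfl

theorem CF_subset_of_permutes {l : Fin n → Submodule ℝ (Fin n → ℝ)} (G : GL (Fin n) ℤ)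
    (π : Equiv.Perm (Fin n)) (h : ∀ i, ∀ x ∈ l i, realOp G x ∈ l (π i)) :
    realOp G '' CF l ⊆ CF l := by
  rintro _ ⟨x, hx, rfl⟩
  obtain ⟨C, ⟨v, hv, rfl⟩, hx⟩ := Set.mem_iUnion₂.1 hx
  refine Set.mem_biUnion (x := realOp G '' _) ?_
    ((realOp_image_sail G _).subset ⟨x, hx, rfl⟩)
  refine ⟨fun i => realOp G (v (π.symm i)), fun i => ⟨?_, ?_⟩, ?_⟩
  · simpa using h _ _ (hv (π.symm i)).1
  · exact fun h0 => (hv (π.symm i)).2 ((realEquiv G).map_eq_zero_iff.1 h0)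
  · ext y
    constructor
    · rintro ⟨x, ⟨c, hc, rfl⟩, rfl⟩
      refine ⟨fun i => c (π.symm i), fun i => hc _, ?_⟩
      rw [map_sum, ← Equiv.sum_comp π.symm]
      simp
    · rintro ⟨c, hc, rfl⟩
      refine ⟨_, ⟨fun i => c (π i), fun i => hc _, rfl⟩, ?_⟩
      rw [map_sum]
      conv_rhs => rw [← Equiv.sum_comp π]
      simp

theorem isSymmetry_of_permutes (b : Module.Basis (Fin n) ℝ (Fin n → ℝ))
    {l : Fin n → Submodule ℝ (Fin n → ℝ)} (hl : ∀ i, l i = Submodule.span ℝ {b i})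
    (G : GL (Fin n) ℤ) (π : Equiv.Perm (Fin n)) (h : ∀ i, realOp G (b i) ∈ l (π i)) :
    IsSymmetry l G := by
  refine (CF_subset_of_permutes G π fun i x hx => ?_).antisymm ?_
  · rw [hl, Submodule.mem_span_singleton] at hx
    obtain ⟨c, rfl⟩ := hx
    rw [map_smul]
    exact Submodule.smul_mem _ _ (h i)
  · have hinv := CF_subset_of_permutes (l := l) G⁻¹ π.symm fun i x hx => by
      have h' := h (π.symm i)
      rw [Equiv.apply_symm_apply, hl, Submodule.mem_span_singleton] at h'
      rw [hl, Submodule.mem_span_singleton] at hx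
      obtain ⟨c, rfl⟩ := hx
      obtain ⟨d, hd⟩ := h'
      have hd0 : d ≠ 0 := by
        rintro rfl
        rw [zero_smul] at hd
        exact b.ne_zero _ ((realEquiv G).map_eq_zero_iff.1 hd.symm)
      have : realOp G⁻¹ (c • b i) = (c / d) • b (π.symm i) := by
        rw [← realOp_inv_apply G ((c / d) • b (π.symm i)), map_smul (realOp G), ← hd, smul_smul,
          div_mul_cancel₀ _ hd0]
      rw [this, hl]
      exact Submodule.smul_mem _ _ (Submodule.mem_span_singleton_self _)
    intro x hx
    exact ⟨realOp G⁻¹ x, hinv ⟨x, hx, rfl⟩, realOp_apply_inv G x⟩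

theorem normForm_realOp_ne_zero [NeZero n] (b : Module.Basis (Fin n) ℝ (Fin n → ℝ))
    {l : Fin n → Submodule ℝ (Fin n → ℝ)} (hl : ∀ i, l i = Submodule.span ℝ {b i}) {δ : ℝ}
    (hδ : 0 < δ) (hb : ∀ x ∈ intPoints n, x ≠ 0 → δ ≤ |normForm b x|) {G : GL (Fin n) ℤ}
    (hG : IsSymmetry l G) {x : Fin n → ℝ} (hx : normForm b (realOp G x) ≠ 0) :
    normForm b x ≠ 0 := by
  rw [normForm_ne_zero_iff_exists_smul_mem_CF b hl hδ hb] at hx ⊢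
  obtain ⟨s, hs, hsx⟩ := hx
  refine ⟨s, hs, ?_⟩
  rw [← hG, ← map_smul] at hsx
  obtain ⟨y, hy, hyx⟩ := hsx
  rwa [← (realEquiv G).injective hyx]

/-- A symmetry preserves the union of the coordinate hyperplanes. As a hyperplane is not covered by
finitely many proper subspaces, the symmetry permutes these hyperplanes, hence also the lines. -/
theorem IsSymmetry.exists_perm [NeZero n] (b : Module.Basis (Fin n) ℝ (Fin n → ℝ))
    {l : Fin n → Submodule ℝ (Fin n → ℝ)} (hl : ∀ i, l i = Submodule.span ℝ {b i}) {δ : ℝ}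
    (hδ : 0 < δ) (hb : ∀ x ∈ intPoints n, x ≠ 0 → δ ≤ |normForm b x|) {G : GL (Fin n) ℤ}
    (hG : IsSymmetry l G) : ∃ π : Equiv.Perm (Fin n), ∀ i, realOp G (b i) ∈ l (π i) := by
  have h1 : ∀ i, ∃ j, ∀ x, b.repr x i = 0 → b.repr (realOp G x) j = 0 := by
    intro i
    have hcov : ⋃ j, ((LinearMap.ker ((b.coord j ∘ₗ realOp G) ∘ₗ
        (LinearMap.ker (b.coord i)).subtype) : Submodule ℝ (LinearMap.ker (b.coord i))) :
          Set (LinearMap.ker (b.coord i))) = Set.univ := by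
      refine Set.eq_univ_of_forall fun x => ?_
      have hx : b.repr x i = 0 := x.2
      have : ¬ ∀ j, b.repr (realOp G x) j ≠ 0 := fun h =>
        normForm_ne_zero_iff.1
          (normForm_realOp_ne_zero b hl hδ hb hG (normForm_ne_zero_iff.2 h)) i hx
      push Not at this
      obtain ⟨j, hj⟩ := this
      exact Set.mem_iUnion.2 ⟨j, hj⟩
    obtain ⟨j, hj⟩ := Subspace.exists_eq_top_of_iUnion_eq_univ hcov
    refine ⟨j, fun x hx => ?_⟩
    have : (⟨x, hx⟩ : LinearMap.ker (b.coord i)) ∈ LinearMap.ker ((b.coord j ∘ₗ realOp G) ∘ₗ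
        (LinearMap.ker (b.coord i)).subtype) := by rw [hj]; trivial
    exact this
  choose π hπ using h1
  have hinj : Function.Injective π := by
    intro i k hik
    by_contra hne
    have hz : ∀ x, b.repr (realOp G x) (π i) = 0 := by
      intro x
      have e1 : b.repr (realOp G (x - b.repr x i • b i)) (π i) = 0 := hπ i _ (by simp)
      have e2 : b.repr (realOp G (b.repr x i • b i)) (π i) = 0 := by
        rw [hik]
        exact hπ k _ (by simp [hne])
      simpa only [map_sub, Finsupp.sub_apply, e2, sub_zero] using e1
    have := hz (realOp G⁻¹ (b (π i)))
    rw [realOp_apply_inv] at this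
    simp at this
  refine ⟨Equiv.ofBijective π (Finite.injective_iff_bijective.1 hinj), fun i => ?_⟩
  rw [Equiv.ofBijective_apply, hl, Submodule.mem_span_singleton]
  refine ⟨b.repr (realOp G (b i)) (π i), b.repr.injective (Finsupp.ext fun j => ?_)⟩
  obtain ⟨k, rfl⟩ := (Finite.injective_iff_surjective.1 hinj) j
  by_cases hk : k = i
  · subst hk
    simp
  · rw [hπ k (b i) (by simp [Ne.symm hk])]
    simp [hinj.ne_iff.2 (Ne.symm hk)]

end Geometry

/-! ### The field of an algebraic continued fraction -/

section Field

variable {n : ℕ}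

/-- An algebraic continued fraction seen through its field `K`: a `ℚ`-basis `v` of `K` with
`v 0 = 1` whose conjugate vectors `e i (v 0), …, e i (v (n - 1))` span the lines, `e` being an
enumeration of the real embeddings of `K`. The last two fields record that the norm form is bounded
away from zero on the nonzero integer points. -/
structure EigenFrame [NeZero n] (l : Fin n → Submodule ℝ (Fin n → ℝ))
    (K : IntermediateField ℚ ℝ) where
  /-- the rational basis of the field formed by the coordinates of the eigenvector -/
  v : Module.Basis (Fin n) ℚ K
  /-- the enumeration of the real embeddings, compatible with that of the lines -/
  e : Fin n ≃ (K →ₐ[ℚ] ℝ)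
  /-- the basis of eigenvectors -/
  b : Module.Basis (Fin n) ℝ (Fin n → ℝ)
  /-- the lower bound for the norm form -/
  δ : ℝ
  v_zero : v 0 = 1
  e_zero : e 0 = K.val
  b_apply : ∀ i j, b i j = e i (v j)
  line_eq : ∀ i, l i = Submodule.span ℝ {b i}
  δ_pos : 0 < δ
  le_normForm : ∀ x ∈ intPoints n, x ≠ 0 → δ ≤ |normForm b x|

theorem isRoot_charpoly_of_realOp_eq {A : GL (Fin n) ℤ} {t : ℝ} {x : Fin n → ℝ} (hx : x ≠ 0)
    (h : realOp A x = t • x) :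
    Polynomial.aeval t ((A : Matrix (Fin n) (Fin n) ℤ).map (Int.cast : ℤ → ℚ)).charpoly = 0 := by
  have h1 : ((A : Matrix (Fin n) (Fin n) ℤ).map (Int.cast : ℤ → ℚ)).map (algebraMap ℚ ℝ) =
      (A : Matrix (Fin n) (Fin n) ℤ).map (Int.cast : ℤ → ℝ) := by
    ext i j; simp
  rw [Polynomial.aeval_def, ← Polynomial.eval_map, ← Matrix.charpoly_map, h1,
    Matrix.eval_charpoly]
  refine Matrix.exists_mulVec_eq_zero_iff.1 ⟨x, hx, ?_⟩
  rw [Matrix.sub_mulVec, sub_eq_zero]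
  simp only [Matrix.scalar_apply]
  rw [← Matrix.smul_one_eq_diagonal, Matrix.smul_mulVec, Matrix.one_mulVec]
  exact h.symm

/-- An eigenvector of a one-dimensional eigenspace, normalized to have first coordinate `1`, has
its coordinates in the field generated by the eigenvalue. -/
theorem mem_adjoin_of_eigenspace_eq_span [NeZero n] {A : GL (Fin n) ℤ} {t : ℝ} {x : Fin n → ℝ}
    (hx0 : x 0 = 1)
    (h : Module.End.eigenspace (realOp A) t = Submodule.span ℝ {x}) (j : Fin n) :
    x j ∈ IntermediateField.adjoin ℚ {t} := by
  set L := IntermediateField.adjoin ℚ {t}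
  have ht : t ∈ L := IntermediateField.mem_adjoin_simple_self ℚ t
  have hx : x ≠ 0 := fun h => by simp [h] at hx0
  let M : Matrix (Fin n) (Fin n) L :=
    (A : Matrix (Fin n) (Fin n) ℤ).map (Int.cast : ℤ → L) - Matrix.scalar _ (⟨t, ht⟩ : L)
  have hM : ∀ u : Fin n → ℝ,
      (M.map (algebraMap L ℝ)).mulVec u = realOp A u - t • u := by
    intro u
    ext i
    have : M.map (algebraMap L ℝ) = (A : Matrix (Fin n) (Fin n) ℤ).map (Int.cast : ℤ → ℝ) -
        t • 1 := by
      ext i j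
      by_cases hij : i = j <;> simp [M, hij]
    rw [this, Matrix.sub_mulVec, Matrix.smul_mulVec, Matrix.one_mulVec]
    rfl
  have hdet : M.det = 0 := by
    have h1 : (M.map (algebraMap L ℝ)).det = 0 := by
      refine Matrix.exists_mulVec_eq_zero_iff.1 ⟨x, hx, ?_⟩
      rw [hM, sub_eq_zero]
      exact Module.End.mem_eigenspace_iff.1 (h ▸ Submodule.mem_span_singleton_self x)
    rw [← RingHom.mapMatrix_apply, ← RingHom.map_det] at h1
    exact (map_eq_zero _).1 h1
  obtain ⟨u, hu, hMu⟩ := Matrix.exists_mulVec_eq_zero_iff.2 hdet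
  have hmem : (fun i => (u i : ℝ)) ∈ Module.End.eigenspace (realOp A) t := by
    rw [Module.End.mem_eigenspace_iff, ← sub_eq_zero, ← hM]
    ext i
    have := congrArg (algebraMap L ℝ) (congrFun hMu i)
    rw [RingHom.map_mulVec] at this
    rw [Pi.zero_apply, map_zero] at this
    exact this
  rw [h, Submodule.mem_span_singleton] at hmem
  obtain ⟨c, hc⟩ := hmem
  have hc' : ∀ i, c * x i = u i := fun i => by simpa using congrFun hc i
  have hc0 : c = u 0 := by simpa [hx0] using hc' 0
  have hc1 : c ≠ 0 := by
    rintro rfl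
    refine hu (funext fun i => ?_)
    have := hc' i
    rw [zero_mul] at this
    exact Subtype.ext this.symm
  have : x j = u j / u 0 := by
    rw [← hc0, ← hc' j, mul_div_cancel_left₀ _ hc1]
  rw [this]
  exact div_mem (u j).2 (u 0).2

/-- A rational matrix polynomial of degree less than `n` in a matrix with irreducible
characteristic polynomial annihilates no nonzero vector. -/
theorem eq_zero_of_aeval_mulVec_eq_zero {A : Matrix (Fin n) (Fin n) ℚ}
    (hA : Irreducible A.charpoly) {p : Polynomial ℚ} (hp : p ≠ 0) (hpn : p.degree < n)
    {z : Fin n → ℚ} (hz : (Polynomial.aeval A p).mulVec z = 0) : z = 0 := by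
  have hco : IsCoprime A.charpoly p := by
    refine (Irreducible.coprime_iff_not_dvd hA).2 fun hdvd => ?_
    have h1 := Polynomial.degree_le_of_dvd hdvd hp
    rw [Matrix.charpoly_degree_eq_dim, Fintype.card_fin] at h1
    exact absurd hpn (not_lt.2 h1)
  obtain ⟨a, c, hac⟩ := hco
  have h1 := congrArg (Polynomial.aeval A) hac
  rw [map_add, map_mul, map_mul, Matrix.aeval_self_charpoly, mul_zero, zero_add, map_one] at h1
  rw [← Matrix.one_mulVec z, ← h1, ← Matrix.mulVec_mulVec, hz, Matrix.mulVec_zero]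

/-- The vectors `z, A z, …, A ^ (n - 1) z` are linearly independent for a nonzero integer vector
`z`, so that their determinant is a nonzero integer. -/
theorem det_krylov_ne_zero {A : GL (Fin n) ℤ}
    (hA : Irreducible ((A : Matrix (Fin n) (Fin n) ℤ).map (Int.cast : ℤ → ℚ)).charpoly)
    {z : Fin n → ℤ} (hz : z ≠ 0) :
    (Matrix.of fun k : Fin n => ((A : Matrix (Fin n) (Fin n) ℤ) ^ (k : ℕ)).mulVec z).det ≠ 0 := by
  intro hdet
  obtain ⟨q, hq, hqz⟩ := Matrix.exists_vecMul_eq_zero_iff.2 hdet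
  set A' := (A : Matrix (Fin n) (Fin n) ℤ).map (Int.cast : ℤ → ℚ)
  let p : Polynomial ℚ := ∑ k : Fin n, Polynomial.monomial (k : ℕ) (q k : ℚ)
  have hcoeff : ∀ k : Fin n, p.coeff k = q k := fun k => by
    simp only [p, Polynomial.finsetSum_coeff, Polynomial.coeff_monomial, Fin.val_inj]
    simp
  have hp : p ≠ 0 := by
    intro h
    refine hq (funext fun k => ?_)
    have := hcoeff k
    rw [h, Polynomial.coeff_zero] at this
    exact_mod_cast this.symm
  have hpn : p.degree < n := by
    refine (Polynomial.degree_sum_le _ _).trans_lt ?_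
    refine (Finset.sup_lt_iff (WithBot.bot_lt_coe n)).2 fun k _ => ?_
    exact (Polynomial.degree_monomial_le _ _).trans_lt (Nat.cast_lt.2 k.2)
  have hz' := eq_zero_of_aeval_mulVec_eq_zero (A := A') (p := p) (z := fun i => (z i : ℚ)) hA hp hpn
    (by
      ext i
      have h1 := congrFun hqz i
      have h2 : ∀ k : ℕ, (A' ^ k).mulVec (fun i => (z i : ℚ)) =
          fun i => ((((A : Matrix (Fin n) (Fin n) ℤ) ^ k).mulVec z i : ℤ) : ℚ) := by
        intro k
        have : A' ^ k = ((A : Matrix (Fin n) (Fin n) ℤ) ^ k).map (Int.castRingHom ℚ) := by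
          rw [Matrix.map_pow]; rfl
        ext i
        rw [this]
        exact (RingHom.map_mulVec (Int.castRingHom ℚ) _ _ i).symm
      simp only [p, map_sum, Polynomial.aeval_monomial, Matrix.sum_mulVec]
      rw [Finset.sum_apply]
      simp only [← Algebra.smul_def, Matrix.smul_mulVec, h2]
      have h3 := congrArg (Int.cast : ℤ → ℚ) h1
      simp only [Matrix.vecMul, dotProduct, Matrix.of_apply, Pi.zero_apply, Int.cast_sum,
        Int.cast_mul, Int.cast_zero] at h3
      simpa using h3)
  refine hz (funext fun i => ?_)
  have := congrFun hz' i
  simpa using this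

/-- The product of the coordinates along the eigenlines is bounded away from zero on the nonzero
integer points `z`: up to the constant factor `det b` times a Vandermonde determinant it is the
nonzero integer `det (z, A z, …, A ^ (n - 1) z)`. -/
theorem exists_pos_le_normForm {A : GL (Fin n) ℤ}
    (hA : Irreducible ((A : Matrix (Fin n) (Fin n) ℤ).map (Int.cast : ℤ → ℚ)).charpoly)
    (b : Module.Basis (Fin n) ℝ (Fin n → ℝ)) {t : Fin n → ℝ}
    (hb : ∀ i, realOp A (b i) = t i • b i) :
    ∃ δ : ℝ, 0 < δ ∧ ∀ x ∈ intPoints n, x ≠ 0 → δ ≤ |normForm b x| := by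
  set D : ℝ := |(Matrix.vandermonde t).det| * |(Matrix.of fun i => b i).det|
  have hD : 0 ≤ D := by positivity
  -- `D` is nonzero, but the weaker bound `1 / (D + 1)` makes a proof of this unnecessary
  refine ⟨1 / (D + 1), by positivity, ?_⟩
  rintro x ⟨z, hz⟩ hx
  have hz0 : z ≠ 0 := by
    rintro rfl
    exact hx (funext fun i => by simp [hz])
  set B := Matrix.of fun k : Fin n => ((A : Matrix (Fin n) (Fin n) ℤ) ^ (k : ℕ)).mulVec z
  have hB : B.det ≠ 0 := det_krylov_ne_zero hA hz0
  have hiter : ∀ k : ℕ, (fun j => ((((A : Matrix (Fin n) (Fin n) ℤ) ^ k).mulVec z j : ℤ) : ℝ)) =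
      ∑ i, (t i ^ k * b.repr x i) • b i := by
    intro k
    induction k with
    | zero =>
      simp only [pow_zero, Matrix.one_mulVec, one_mul, b.sum_repr]
      exact funext fun j => (hz j).symm
    | succ k ih =>
      have : (fun j => ((((A : Matrix (Fin n) (Fin n) ℤ) ^ (k + 1)).mulVec z j : ℤ) : ℝ)) =
          realOp A
            (fun j => ((((A : Matrix (Fin n) (Fin n) ℤ) ^ k).mulVec z j : ℤ) : ℝ)) := by
        ext j
        rw [realOp_apply, pow_succ', ← Matrix.mulVec_mulVec]
        simp [Matrix.mulVec, dotProduct]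
      rw [this, ih, map_sum]
      refine Finset.sum_congr rfl fun i _ => ?_
      rw [map_smul, hb, smul_smul]
      ring_nf
  have hfac : B.map (Int.castRingHom ℝ) = (Matrix.vandermonde t).transpose *
      Matrix.diagonal (fun i => b.repr x i) * Matrix.of fun i => b i := by
    ext k j
    have := congrFun (hiter k) j
    simp only [Finset.sum_apply, Pi.smul_apply, smul_eq_mul] at this
    rw [Matrix.mul_apply]
    simp only [Matrix.mul_diagonal, Matrix.transpose_apply,
      Matrix.vandermonde_apply, Matrix.of_apply, Matrix.map_apply, B]
    exact this
  have hdet := congrArg Matrix.det hfac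
  rw [Matrix.det_mul, Matrix.det_mul, Matrix.det_transpose, Matrix.det_diagonal,
    ← RingHom.mapMatrix_apply, ← RingHom.map_det] at hdet
  have h1 : (1 : ℝ) ≤ |(Int.castRingHom ℝ) B.det| := by
    rw [eq_intCast, ← Int.cast_abs]
    exact_mod_cast Int.one_le_abs hB
  have h2 : |(Int.castRingHom ℝ) B.det| = D * |normForm b x| := by
    rw [hdet, abs_mul, abs_mul, normForm]
    ring
  rw [div_le_iff₀ (by positivity)]
  nlinarith [abs_nonneg (normForm b x)]

/-- Every algebraic continued fraction has an eigenframe: the eigenvalue `t 0` generates `K`, and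
sending it to the eigenvalues `t i` gives all real embeddings of `K`. -/
theorem IsAlgebraic.nonempty_eigenFrame [NeZero n] {l : Fin n → Submodule ℝ (Fin n → ℝ)}
    (hl : IsAlgebraic l) {x : Fin n → ℝ} (hx0 : x 0 = 1) (hlx : l 0 = Submodule.span ℝ {x})
    {K : IntermediateField ℚ ℝ} (hK : K = IntermediateField.adjoin ℚ (Set.range x)) :
    ∃ F : EigenFrame l K, ∀ j, (F.v j : ℝ) = x j := by
  obtain ⟨A, ⟨-, hirr⟩, t, htinj, ht⟩ := hl
  set χ := ((A : Matrix (Fin n) (Fin n) ℤ).map (Int.cast : ℤ → ℚ)).charpoly with hχ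
  have hxK : ∀ j, x j ∈ K := fun j => hK ▸ IntermediateField.subset_adjoin _ _ ⟨j, rfl⟩
  have hAx : realOp A x = t 0 • x :=
    Module.End.mem_eigenspace_iff.1 ((ht 0).2 ▸ hlx ▸ Submodule.mem_span_singleton_self x)
  have htK : t 0 ∈ K := by
    have : t 0 = realOp A x 0 := by rw [hAx]; simp [hx0]
    rw [this, realOp_apply]
    exact sum_mem fun j _ => mul_mem (intCast_mem _ _) (hxK j)
  have hK' : K = IntermediateField.adjoin ℚ {t 0} := by
    apply le_antisymm
    · rw [hK, IntermediateField.adjoin_le_iff]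
      rintro _ ⟨j, rfl⟩
      exact mem_adjoin_of_eigenspace_eq_span hx0 ((ht 0).2 ▸ hlx) j
    · rw [IntermediateField.adjoin_le_iff]
      simpa using htK
  have hroot : ∀ i, Polynomial.aeval (t i) χ = 0 := fun i => by
    obtain ⟨y, hy⟩ := (ht i).1.exists_hasEigenvector
    exact isRoot_charpoly_of_realOp_eq hy.2 hy.apply_eq_smul
  have hmin : χ = minpoly ℚ (t 0) :=
    minpoly.eq_of_irreducible_of_monic hirr (hroot 0) (Matrix.charpoly_monic _)
  have hint : IsIntegral ℚ (t 0) := ⟨χ, Matrix.charpoly_monic _, hroot 0⟩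
  have hfin : Module.finrank ℚ K = n := by
    rw [hK', IntermediateField.adjoin.finrank hint, ← hmin, Matrix.charpoly_natDegree_eq_dim,
      Fintype.card_fin]
  have hemb : ∀ i, ∃ σ : K →ₐ[ℚ] ℝ, σ ⟨t 0, htK⟩ = t i := by
    subst hK'
    intro i
    have hmem : t i ∈ (minpoly ℚ (t 0)).aroots ℝ := by
      rw [← hmin, Polynomial.mem_aroots]
      exact ⟨hirr.ne_zero, hroot i⟩
    exact ⟨(IntermediateField.algHomAdjoinIntegralEquiv ℚ hint).symm ⟨t i, hmem⟩,
      IntermediateField.algHomAdjoinIntegralEquiv_symm_apply_gen ℚ hint ⟨t i, hmem⟩⟩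
  have hext : ∀ σ τ : K →ₐ[ℚ] ℝ, σ ⟨t 0, htK⟩ = τ ⟨t 0, htK⟩ → σ = τ := fun σ τ h =>
    IntermediateField.algHom_ext_of_eq_adjoin ℚ hK' fun y hy => by
      obtain rfl : y = t 0 := hy
      exact h
  have hconj : ∀ σ : K →ₐ[ℚ] ℝ, realOp A (fun j => σ ⟨x j, hxK j⟩) =
      σ ⟨t 0, htK⟩ • fun j => σ ⟨x j, hxK j⟩ := by
    intro σ
    ext i
    have h1 : (∑ j, ((A : Matrix (Fin n) (Fin n) ℤ) i j : K) * ⟨x j, hxK j⟩ : K) =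
        ⟨t 0, htK⟩ * ⟨x i, hxK i⟩ := by
      apply Subtype.ext
      have := congrFun hAx i
      rw [realOp_apply] at this
      push_cast
      simpa using this
    have h2 := congrArg σ h1
    rw [map_mul] at h2
    rw [realOp_apply, Pi.smul_apply, smul_eq_mul]
    simpa only [map_sum, map_mul, map_intCast] using h2
  have hone : (⟨x 0, hxK 0⟩ : K) = 1 := Subtype.ext hx0
  have hne : ∀ σ : K →ₐ[ℚ] ℝ, (fun j => σ ⟨x j, hxK j⟩) ≠ 0 := fun σ h => by
    have := congrFun h 0
    simp [hone] at this
  choose e he using hemb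
  have hlin : LinearIndependent ℝ fun i j => e i ⟨x j, hxK j⟩ :=
    Module.End.eigenvectors_linearIndependent' (realOp A) t htinj _ fun i =>
      ⟨Module.End.mem_eigenspace_iff.2 ((he i) ▸ hconj (e i)), hne _⟩
  let b : Module.Basis (Fin n) ℝ (Fin n → ℝ) :=
    basisOfLinearIndependentOfCardEqFinrank hlin (by simp)
  have hb : ∀ i j, b i j = e i ⟨x j, hxK j⟩ := fun i j => by simp [b]
  have hbA : ∀ i, realOp A (b i) = t i • b i := fun i => by
    have : b i = fun j => e i ⟨x j, hxK j⟩ := funext (hb i)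
    rw [this, hconj, he]
  have hcoord : ∀ (s : ℝ) (y : Fin n → ℝ), realOp A y = s • y →
      ∀ i, b.repr y i ≠ 0 → s = t i := by
    intro s y hy i hi
    have h1 : b.repr (realOp A y) i = t i * b.repr y i := by
      conv_lhs => rw [← b.sum_repr y]
      simp only [map_sum, map_smul, hbA, Finsupp.coe_finsetSum, Finset.sum_apply,
        Finsupp.smul_apply, smul_eq_mul, b.repr_self_apply]
      rw [Finset.sum_eq_single i]
      · simp [mul_comm]
      · intro k _ hk
        simp [hk]
      · simp
    rw [hy, map_smul, Finsupp.smul_apply, smul_eq_mul] at h1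
    exact mul_right_cancel₀ hi h1
  have hbij : Function.Bijective e := by
    constructor
    · intro i j hij
      apply htinj
      rw [← he i, ← he j, hij]
    · intro σ
      obtain ⟨i, hi⟩ : ∃ i, b.repr (fun j => σ ⟨x j, hxK j⟩) i ≠ 0 := by
        by_contra! h
        exact hne σ (b.repr.map_eq_zero_iff.1 (Finsupp.ext h))
      exact ⟨i, hext _ _ ((he i).trans (hcoord _ _ (hconj σ) i hi).symm)⟩
  obtain ⟨δ, hδ, hδb⟩ := exists_pos_le_normForm hirr b hbA
  have hv : LinearIndependent ℚ fun j => (⟨x j, hxK j⟩ : K) := by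
    rw [Fintype.linearIndependent_iff]
    intro q hq j
    have h1 : ∑ j, (q j : ℝ) • LinearMap.proj j = (0 : (Fin n → ℝ) →ₗ[ℝ] ℝ) := by
      refine b.ext fun i => ?_
      have := congrArg (e i) hq
      rw [map_sum, map_zero] at this
      simpa [hb, Algebra.smul_def] using this
    have h2 := LinearMap.congr_fun h1 (Pi.single j 1)
    simpa [Pi.single_apply] using h2
  refine ⟨⟨basisOfLinearIndependentOfCardEqFinrank hv (by simp [hfin]), Equiv.ofBijective e hbij,
    b, δ, ?_, ?_, ?_, ?_, hδ, hδb⟩, ?_⟩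
  · simp [hone]
  · exact hext _ _ (he 0)
  · intro i j
    simp [hb]
  · intro i
    rw [(ht i).2]
    ext y
    rw [Module.End.mem_eigenspace_iff, Submodule.mem_span_singleton]
    constructor
    · intro hy
      refine ⟨b.repr y i, ?_⟩
      conv_rhs => rw [← b.sum_repr y]
      rw [Finset.sum_eq_single i _ (by simp)]
      intro k _ hk
      by_cases h0 : b.repr y k = 0
      · rw [h0, zero_smul]
      · exact absurd (htinj (hcoord _ _ hy k h0)) hk.symm
    · rintro ⟨c, rfl⟩
      rw [map_smul, hbA, smul_comm]
  · intro j
    simp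

end Field

/-! ### Integer involutions -/

section Involution

/-- An involution `f` of a free `ℤ`-module of finite rank is block triangular: the fixed sublattice
has a complement, and `f x + x` is fixed for every `x`. -/
theorem exists_basis_of_involution {M : Type*} [AddCommGroup M] [Module.Free ℤ M]
    [Module.Finite ℤ M] (f : M →ₗ[ℤ] M) (hf : ∀ x, f (f x) = x) :
    ∃ (r s : ℕ) (b : Module.Basis (Fin r ⊕ Fin s) ℤ M) (c : Fin s → Fin r → ℤ),
      (∀ i, f (b (Sum.inl i)) = b (Sum.inl i)) ∧
      (∀ i, f (b (Sum.inr i)) = -b (Sum.inr i) + ∑ k, c i k • b (Sum.inl k)) ∧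
      LinearMap.trace ℤ M f = r - s := by
  let g : M →ₗ[ℤ] M := LinearMap.id - f
  have hg : ∀ x, x ∈ LinearMap.ker g ↔ f x = x := fun x => by
    rw [LinearMap.mem_ker, LinearMap.sub_apply, LinearMap.id_apply, sub_eq_zero, eq_comm]
  obtain ⟨σ, hσ⟩ := Module.projective_lifting_property g.rangeRestrict LinearMap.id
    g.surjective_rangeRestrict
  have hcompl : IsCompl (LinearMap.ker g) (LinearMap.range σ) := by
    have hσ' : ∀ y, g (σ y) = y := fun y => congrArg Subtype.val (LinearMap.congr_fun hσ y)
    constructor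
    · rw [Submodule.disjoint_def]
      rintro _ hx ⟨y, rfl⟩
      have : y = 0 := Subtype.ext ((hσ' y).symm.trans (LinearMap.mem_ker.1 hx))
      rw [this, map_zero]
    · rw [codisjoint_iff, eq_top_iff]
      intro x _
      refine Submodule.mem_sup.2 ⟨x - σ (g.rangeRestrict x), ?_, σ (g.rangeRestrict x), ⟨_, rfl⟩,
        sub_add_cancel _ _⟩
      rw [LinearMap.mem_ker, map_sub, hσ']
      exact sub_self _
  set p := LinearMap.ker g
  set q := LinearMap.range σ
  let bp := Module.finBasis ℤ p
  let b := (bp.prod (Module.finBasis ℤ q)).map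
    (Submodule.prodEquivOfIsCompl p q hcompl)
  have hbl : ∀ i, b (Sum.inl i) = bp i := fun i => by simp [b]
  have h1 : ∀ i, f (b (Sum.inl i)) = b (Sum.inl i) := fun i => by
    rw [hbl]
    exact (hg _).1 (bp i).2
  have hfix : ∀ x, f x + x ∈ p := fun x => by
    rw [hg, map_add, hf, add_comm]
  let c : Fin (Module.finrank ℤ q) → Fin (Module.finrank ℤ p) → ℤ := fun i k =>
    bp.repr ⟨_, hfix (b (Sum.inr i))⟩ k
  have h2 : ∀ i, f (b (Sum.inr i)) = -b (Sum.inr i) + ∑ k, c i k • b (Sum.inl k) := fun i => by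
    have h := congrArg Subtype.val (bp.sum_repr ⟨_, hfix (b (Sum.inr i))⟩)
    simp only [Submodule.coe_sum, Submodule.coe_smul] at h
    simp only [hbl, c, h]
    abel
  refine ⟨_, _, b, c, h1, h2, ?_⟩
  rw [LinearMap.trace_eq_matrix_trace ℤ b f, Matrix.trace, Fintype.sum_sum_type]
  simp [LinearMap.toMatrix_apply, h1, h2, sub_eq_add_neg]

/-- The block triangular normal form of an integer involution of trace zero. -/
def involutionBlock (p q r s : ℤ) : Matrix (Fin 4) (Fin 4) ℤ :=
  !![1, 0, 0, 0; 0, 1, 0, 0; p, q, -1, 0; r, s, 0, -1]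

/-- The involution `(1, ω, ψ, ω') ↦ (1, ω', m - ω - ω' - ψ, ω)`. -/
def swapMatrix (m : ℤ) : Matrix (Fin 4) (Fin 4) ℤ :=
  !![1, 0, 0, 0; 0, 0, 0, 1; m, -1, -1, -1; 0, 1, 0, 0]

/-- The involution `(1, ω, ψ, s) ↦ (1, 2 s - a - ω, m - k s - ψ, s)`. -/
def reflMatrix (a m k : ℤ) : Matrix (Fin 4) (Fin 4) ℤ :=
  !![1, 0, 0, 0; -a, -1, 0, 2; m, 0, -1, -k; 0, 0, 0, 1]

/-- The involution `(1, ω, ψ, d) ↦ (1, ω + 4 d, 2 - ω - 2 d - ψ, -d)`. -/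
def shearMatrix : Matrix (Fin 4) (Fin 4) ℤ :=
  !![1, 0, 0, 0; 0, 1, 0, 4; 2, -1, -1, -2; 0, 0, 0, -1]

theorem swapMatrix_mul_self (m : ℤ) : swapMatrix m * swapMatrix m = 1 := by
  ext i j
  fin_cases i <;> fin_cases j <;> simp [swapMatrix, Matrix.mul_apply, Fin.sum_univ_four]

theorem reflMatrix_mul_self (a m k : ℤ) : reflMatrix a m k * reflMatrix a m k = 1 := by
  ext i j
  fin_cases i <;> fin_cases j <;> simp [reflMatrix, Matrix.mul_apply, Fin.sum_univ_four]

theorem shearMatrix_mul_self : shearMatrix * shearMatrix = 1 := by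
  ext i j
  fin_cases i <;> fin_cases j <;> simp [shearMatrix, Matrix.mul_apply, Fin.sum_univ_four]

/-- Conjugacy of integer matrices under `GL₄(ℤ)`. -/
def IntConj (T N : Matrix (Fin 4) (Fin 4) ℤ) : Prop :=
  ∃ X : GL (Fin 4) ℤ, (X : Matrix (Fin 4) (Fin 4) ℤ) * T = N * X

theorem IntConj.trans {T N P : Matrix (Fin 4) (Fin 4) ℤ} (h₁ : IntConj T N) (h₂ : IntConj N P) :
    IntConj T P := by
  obtain ⟨X, hX⟩ := h₁
  obtain ⟨Y, hY⟩ := h₂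
  refine ⟨Y * X, ?_⟩
  rw [Units.val_mul, Matrix.mul_assoc, hX, ← Matrix.mul_assoc, hY, Matrix.mul_assoc]

theorem IntConj.of_isUnit_det {T N Y : Matrix (Fin 4) (Fin 4) ℤ} (hY : IsUnit Y.det)
    (h : Y * T = N * Y) : IntConj T N :=
  ⟨Matrix.GeneralLinearGroup.mk'' Y hY, h⟩

theorem exists_intConj_involutionBlock {T : Matrix (Fin 4) (Fin 4) ℤ} (hT : T * T = 1)
    (htr : T.trace = 0) : ∃ p q r s : ℤ, IntConj T (involutionBlock p q r s) := by
  let f : (Fin 4 → ℤ) →ₗ[ℤ] (Fin 4 → ℤ) := Matrix.toLin' T.transpose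
  have hfa : ∀ x, f x = Matrix.vecMul x T := fun x => by
    rw [Matrix.toLin'_apply, Matrix.mulVec_transpose]
  obtain ⟨n₁, n₂, b, c, h1, h2, htrace⟩ := exists_basis_of_involution f fun x => by
    rw [hfa, hfa, Matrix.vecMul_vecMul, hT, Matrix.vecMul_one]
  rw [Matrix.trace_toLin'_eq, Matrix.trace_transpose, htr] at htrace
  have hcard := Module.finrank_eq_card_basis b
  simp only [Module.finrank_fintype_fun_eq_card, Fintype.card_fin, Fintype.card_sum] at hcard
  obtain rfl : n₁ = 2 := by omega
  obtain rfl : n₂ = 2 := by omega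
  let B : Module.Basis (Fin 4) ℤ (Fin 4 → ℤ) := b.reindex finSumFinEquiv
  have hB : B 0 = b (Sum.inl 0) ∧ B 1 = b (Sum.inl 1) ∧ B 2 = b (Sum.inr 0) ∧
      B 3 = b (Sum.inr 1) := by
    simp only [B, Module.Basis.reindex_apply]
    exact ⟨rfl, rfl, congrArg b (by decide), congrArg b (by decide)⟩
  obtain ⟨B0, B1, B2, B3⟩ := hB
  let Y : Matrix (Fin 4) (Fin 4) ℤ := Matrix.of fun i => B i
  have hY : IsUnit Y.det := by
    have hu := (Pi.basisFun ℤ (Fin 4)).isUnit_det B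
    rwa [Module.Basis.det_apply, ← Matrix.det_transpose] at hu
  refine ⟨c 0 0, c 0 1, c 1 0, c 1 1, .of_isUnit_det hY ?_⟩
  have hrow : ∀ i, (Y * T) i = f (B i) := fun i => by rw [hfa]; rfl
  ext i j
  rw [hrow]
  fin_cases i
  · simp [Y, B0, h1, involutionBlock, Matrix.mul_apply, Fin.sum_univ_four]
  · simp [Y, B1, h1, involutionBlock, Matrix.mul_apply, Fin.sum_univ_four]
  · simp [Y, B0, B1, B2, h2, involutionBlock, Matrix.mul_apply, Fin.sum_univ_four]
    ring
  · simp [Y, B0, B1, B3, h2, involutionBlock, Matrix.mul_apply, Fin.sum_univ_four]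
    ring

/-- Adding fixed vectors to the complement of the fixed lattice changes the off-diagonal block by
even entries. -/
theorem intConj_involutionBlock_emod (p q r s : ℤ) :
    IntConj (involutionBlock p q r s) (involutionBlock (p % 2) (q % 2) (r % 2) (s % 2)) := by
  refine .of_isUnit_det (Y := !![1, 0, 0, 0; 0, 1, 0, 0; -(p / 2), -(q / 2), 1, 0;
    -(r / 2), -(s / 2), 0, 1]) ?_ ?_
  · simp [Matrix.det_succ_row_zero, Fin.sum_univ_succ]
  · ext i j
    fin_cases i <;> fin_cases j <;>
      simp [involutionBlock, Matrix.mul_apply, Fin.sum_univ_four] <;> omega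

/-- Off-diagonal block of rank two: the rows of the conjugating matrix are `h₁ + f h₁`,
`h₂`, `h₁ - h₂` and `f h₂`, where `h₁`, `h₂` span the complement of the fixed lattice. -/
theorem intConj_swapMatrix_one {p q r s : ℤ} (h : p * s - q * r = 1 ∨ p * s - q * r = -1) :
    IntConj (involutionBlock p q r s) (swapMatrix 1) := by
  refine .of_isUnit_det (Y := !![p, q, 0, 0; 0, 0, 0, 1; 0, 0, 1, -1; r, s, 0, -1]) ?_ ?_
  · rw [Int.isUnit_iff]
    simp [Matrix.det_succ_row_zero, Fin.sum_univ_succ, Fin.succAbove]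
    omega
  · ext i j
    fin_cases i <;> fin_cases j <;>
      simp [swapMatrix, involutionBlock, Matrix.mul_apply, Fin.sum_univ_four]

/-- Off-diagonal block of rank one, with zero second row: the vector `(x, y)` completes the first row
to a basis of the fixed lattice. -/
theorem intConj_swapMatrix_zero {p q x y : ℤ} (h : x * q - y * p = 1 ∨ x * q - y * p = -1) :
    IntConj (involutionBlock p q 0 0) (swapMatrix 0) := by
  refine .of_isUnit_det (Y := !![x, y, 0, 0; 0, 0, 1, 0; 0, 0, -1, 1; p, q, -1, 0]) ?_ ?_
  · rw [Int.isUnit_iff]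
    simp [Matrix.det_succ_row_zero, Fin.sum_univ_succ, Fin.succAbove]
    omega
  · ext i j
    fin_cases i <;> fin_cases j <;>
      simp [swapMatrix, involutionBlock, Matrix.mul_apply, Fin.sum_univ_four]

theorem intConj_reflMatrix : IntConj (involutionBlock 0 0 0 0) (reflMatrix 0 0 2) := by
  refine .of_isUnit_det (Y := !![1, 0, 0, 0; 0, 1, 1, 0; 0, -1, 0, 1; 0, 1, 0, 0]) ?_ ?_
  · rw [Int.isUnit_iff]
    simp [Matrix.det_succ_row_zero, Fin.sum_univ_succ, Fin.succAbove]
  · ext i j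
    fin_cases i <;> fin_cases j <;>
      simp [reflMatrix, involutionBlock, Matrix.mul_apply, Fin.sum_univ_four]

/-- A change of basis in the complement of the fixed lattice acts on the off-diagonal block by row
operations. -/
theorem intConj_involutionBlock_rows (k₁ k₂ k₃ k₄ p q r s : ℤ)
    (h : k₁ * k₄ - k₂ * k₃ = 1 ∨ k₁ * k₄ - k₂ * k₃ = -1) :
    IntConj (involutionBlock p q r s) (involutionBlock (k₁ * p + k₂ * r) (k₁ * q + k₂ * s)
      (k₃ * p + k₄ * r) (k₃ * q + k₄ * s)) := by
  refine .of_isUnit_det (Y := !![1, 0, 0, 0; 0, 1, 0, 0; 0, 0, k₁, k₂; 0, 0, k₃, k₄]) ?_ ?_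
  · rw [Int.isUnit_iff]
    simp [Matrix.det_succ_row_zero, Fin.sum_univ_succ, Fin.succAbove]
    omega
  · ext i j
    fin_cases i <;> fin_cases j <;>
      simp [involutionBlock, Matrix.mul_apply, Fin.sum_univ_four]

/-- Up to conjugation in `GL₄(ℤ)` there are at most three integer involutions of trace zero,
according to the rank modulo `2` of the off-diagonal block of the triangular normal form. -/
theorem intConj_of_involution {T : Matrix (Fin 4) (Fin 4) ℤ} (hT : T * T = 1)
    (htr : T.trace = 0) :
    IntConj T (swapMatrix 0) ∨ IntConj T (swapMatrix 1) ∨ IntConj T (reflMatrix 0 0 2) := by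
  obtain ⟨p, q, r, s, h⟩ := exists_intConj_involutionBlock hT htr
  replace h := h.trans (intConj_involutionBlock_emod p q r s)
  have hp := Int.emod_two_eq_zero_or_one p
  have hq := Int.emod_two_eq_zero_or_one q
  have hr := Int.emod_two_eq_zero_or_one r
  have hs := Int.emod_two_eq_zero_or_one s
  generalize p % 2 = p at *
  generalize q % 2 = q at *
  generalize r % 2 = r at *
  generalize s % 2 = s at *
  by_cases hdet : p * s - q * r = 0
  · by_cases hrs : r = 0 ∧ s = 0
    · obtain ⟨rfl, rfl⟩ := hrs
      by_cases hpq : p = 0 ∧ q = 0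
      · obtain ⟨rfl, rfl⟩ := hpq
        exact Or.inr (Or.inr (h.trans intConj_reflMatrix))
      · refine Or.inl (h.trans (intConj_swapMatrix_zero (x := q) (y := 1 - q) ?_))
        rcases hp with rfl | rfl <;> rcases hq with rfl | rfl <;> simp_all
    · -- a row operation clears the second row
      by_cases hpq : p = 0 ∧ q = 0
      · obtain ⟨rfl, rfl⟩ := hpq
        replace h := h.trans (intConj_involutionBlock_rows 0 1 1 0 0 0 r s (by simp))
        norm_num at h
        refine Or.inl (h.trans (intConj_swapMatrix_zero (x := s) (y := 1 - s) ?_))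
        rcases hr with rfl | rfl <;> rcases hs with rfl | rfl <;> simp_all
      · obtain ⟨rfl, rfl⟩ : r = p ∧ s = q := by
          rcases hp with rfl | rfl <;> rcases hq with rfl | rfl <;> rcases hr with rfl | rfl <;>
            rcases hs with rfl | rfl <;> simp_all
        replace h := h.trans (intConj_involutionBlock_rows 1 0 (-1) 1 r s r s (by simp))
        norm_num at h
        refine Or.inl (h.trans (intConj_swapMatrix_zero (x := s) (y := 1 - s) ?_))
        rcases hr with rfl | rfl <;> rcases hs with rfl | rfl <;> simp_all
  · refine Or.inr (Or.inl (h.trans (intConj_swapMatrix_one ?_)))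
    rcases hp with rfl | rfl <;> rcases hq with rfl | rfl <;> rcases hr with rfl | rfl <;>
      rcases hs with rfl | rfl <;> simp_all

end Involution

/-! ### Permutations of the lines as automorphisms of the field -/

section Galois

variable {n : ℕ}

/-- An integer matrix acting on vectors with coordinates in an arbitrary ring. -/
def intMulVec {R : Type*} [Ring R] (T : Matrix (Fin n) (Fin n) ℤ) (w : Fin n → R) : Fin n → R :=
  fun i => ∑ j, (T i j : R) * w j

theorem intMulVec_mul {R : Type*} [Ring R] (S T : Matrix (Fin n) (Fin n) ℤ) (w : Fin n → R) :
    intMulVec (S * T) w = intMulVec S (intMulVec T w) := by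
  ext i
  simp only [intMulVec, Matrix.mul_apply, Int.cast_sum, Int.cast_mul, Finset.sum_mul,
    Finset.mul_sum, mul_assoc]
  exact Finset.sum_comm

theorem intMulVec_one {R : Type*} [Ring R] (w : Fin n → R) :
    intMulVec (1 : Matrix (Fin n) (Fin n) ℤ) w = w := by
  ext i
  simp [intMulVec, Matrix.one_apply]

theorem map_intMulVec {R S F : Type*} [Ring R] [Ring S] [FunLike F R S] [RingHomClass F R S]
    (σ : F) (T : Matrix (Fin n) (Fin n) ℤ) (w : Fin n → R) (i : Fin n) :
    σ (intMulVec T w i) = intMulVec T (fun j => σ (w j)) i := by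
  simp [intMulVec]

theorem intMulVec_const_mul {R : Type*} [CommRing R] (T : Matrix (Fin n) (Fin n) ℤ) (c : R)
    (w : Fin n → R) : intMulVec T (fun j => c * w j) = fun i => c * intMulVec T w i := by
  ext i
  simp only [intMulVec, Finset.mul_sum]
  exact Finset.sum_congr rfl fun j _ => by ring

theorem realOp_eq_intMulVec (G : GL (Fin n) ℤ) (x : Fin n → ℝ) :
    realOp G x = intMulVec (G : Matrix (Fin n) (Fin n) ℤ) x :=
  funext fun i => realOp_apply G x i

theorem realOp_injective : Function.Injective (realOp (n := n)) := by
  intro G H h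
  ext i j
  have := congrFun (LinearMap.congr_fun h (Pi.single j 1)) i
  rw [realOp_apply, realOp_apply] at this
  simpa [Pi.single_apply] using this

variable [NeZero n] {l : Fin n → Submodule ℝ (Fin n → ℝ)} {K : IntermediateField ℚ ℝ}

namespace EigenFrame

theorem eq_of_mem_line (F : EigenFrame l K) {i j : Fin n} {c : ℝ} (hc : c ≠ 0)
    (h : c • F.b i ∈ l j) : i = j := by
  rw [F.line_eq, Submodule.mem_span_singleton] at h
  obtain ⟨d, hd⟩ := h
  by_contra hne
  have := congrArg (fun y => F.b.repr y i) hd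
  simp [Ne.symm hne] at this
  exact hc this.symm

/-- The permutation of the lines induced by an automorphism of the field. -/
noncomputable def shift (F : EigenFrame l K) (τ : K →ₐ[ℚ] K) (i : Fin n) : Fin n :=
  F.e.symm ((F.e i).comp τ)

theorem e_shift (F : EigenFrame l K) (τ : K →ₐ[ℚ] K) (i : Fin n) (x : K) :
    F.e (F.shift τ i) x = F.e i (τ x) := by
  simp [shift]

theorem eq_id_of_shift_eq (F : EigenFrame l K) {τ : K →ₐ[ℚ] K} {i : Fin n}
    (h : F.shift τ i = i) (x : K) : τ x = x := by
  have h1 := F.e_shift τ i x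
  rw [h] at h1
  exact (F.e i).injective h1.symm

theorem shift_eq_self (F : EigenFrame l K) {τ : K →ₐ[ℚ] K} (h : ∀ x, τ x = x) (i : Fin n) :
    F.shift τ i = i := by
  apply F.e.injective
  ext x
  rw [e_shift, h]

theorem shift_involutive (F : EigenFrame l K) {τ : K →ₐ[ℚ] K} (hτ : ∀ x, τ (τ x) = x) :
    Function.Involutive (F.shift τ) := fun i => F.e.injective (by
  ext x
  rw [F.e_shift, F.e_shift, hτ])

theorem realOp_b (F : EigenFrame l K) (G : GL (Fin n) ℤ) (i j : Fin n) :
    realOp G (F.b i) j = F.e i (intMulVec (G : Matrix (Fin n) (Fin n) ℤ) F.v j) := by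
  rw [map_intMulVec, realOp_eq_intMulVec]
  congr 1
  exact funext fun k => F.b_apply i k

theorem realOp_b_ne_zero (F : EigenFrame l K) (G : GL (Fin n) ℤ) (i : Fin n) :
    realOp G (F.b i) ≠ 0 := fun h =>
  F.b.ne_zero i ((realEquiv G).map_eq_zero_iff.1 h)

/-- If `G v = μ τ(v)` for an automorphism `τ`, then conjugation shows that `G` maps each line to a
line. -/
theorem realOp_b_eq (F : EigenFrame l K) {G : GL (Fin n) ℤ} {τ : K →ₐ[ℚ] K} {μ : K}
    (h : ∀ j, intMulVec (G : Matrix (Fin n) (Fin n) ℤ) F.v j = μ * τ (F.v j)) (i : Fin n) :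
    realOp G (F.b i) = F.e i μ • F.b (F.shift τ i) := by
  ext j
  rw [realOp_b, h, map_mul, Pi.smul_apply, smul_eq_mul, F.b_apply, F.e_shift]

theorem realOp_b_mem (F : EigenFrame l K) {G : GL (Fin n) ℤ} {τ : K →ₐ[ℚ] K} {μ : K}
    (h : ∀ j, intMulVec (G : Matrix (Fin n) (Fin n) ℤ) F.v j = μ * τ (F.v j)) (i : Fin n) :
    realOp G (F.b i) ∈ l (F.shift τ i) := by
  rw [F.realOp_b_eq h, F.line_eq]
  exact Submodule.smul_mem _ _ (Submodule.mem_span_singleton_self _)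

/-- If `G` maps the rational line `l 0` to the line `l j`, then `l j` is also spanned by a vector
over `K`, so that the `j`-th embedding is an automorphism of `K`. -/
theorem exists_algHom (F : EigenFrame l K) {G : GL (Fin n) ℤ} {j : Fin n}
    (h : realOp G (F.b 0) ∈ l j) :
    ∃ (τ : K →ₐ[ℚ] K) (μ : K), (∀ x, (τ x : ℝ) = F.e j x) ∧
      ∀ k, intMulVec (G : Matrix (Fin n) (Fin n) ℤ) F.v k = μ * τ (F.v k) := by
  rw [F.line_eq, Submodule.mem_span_singleton] at h
  obtain ⟨c, hc⟩ := h
  set u := intMulVec (G : Matrix (Fin n) (Fin n) ℤ) F.v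
  have hc' : ∀ k, c * F.e j (F.v k) = u k := fun k => by
    have := congrFun hc k
    rwa [F.realOp_b, F.e_zero, Pi.smul_apply, smul_eq_mul, F.b_apply] at this
  have hc0 : c = u 0 := by
    have := hc' 0
    rwa [F.v_zero, map_one, mul_one] at this
  have hc1 : c ≠ 0 := by
    rintro rfl
    rw [zero_smul] at hc
    exact F.realOp_b_ne_zero G 0 hc.symm
  have hv : ∀ k, F.e j (F.v k) ∈ K := fun k => by
    have : F.e j (F.v k) = u k / u 0 := by
      rw [← hc0, ← hc' k, mul_div_cancel_left₀ _ hc1]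
    rw [this]
    exact div_mem (u k).2 (u 0).2
  have hK : ∀ x, F.e j x ∈ K.toSubalgebra := fun x => by
    rw [← F.v.sum_repr x, map_sum]
    refine sum_mem fun k _ => ?_
    rw [Algebra.smul_def, map_mul, AlgHom.commutes]
    exact mul_mem (Subalgebra.algebraMap_mem _ _) (hv k)
  refine ⟨AlgHom.codRestrict (F.e j) K.toSubalgebra hK, u 0, fun x => rfl, fun k => ?_⟩
  apply Subtype.ext
  change (u k : ℝ) = u 0 * F.e j (F.v k)
  rw [← hc0, hc']

/-- The permutation of the lines by `G` is the one induced by the automorphism. -/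
theorem shift_eq_of_mem (F : EigenFrame l K) {G : GL (Fin n) ℤ} {τ : K →ₐ[ℚ] K} {μ : K}
    (hτ : ∀ j, intMulVec (G : Matrix (Fin n) (Fin n) ℤ) F.v j = μ * τ (F.v j))
    {π : Fin n → Fin n} (h : ∀ i, realOp G (F.b i) ∈ l (π i)) (i : Fin n) :
    F.shift τ i = π i := by
  have h1 := h i
  rw [F.realOp_b_eq hτ] at h1
  refine F.eq_of_mem_line (fun h0 => F.realOp_b_ne_zero G i ?_) h1
  rw [F.realOp_b_eq hτ, h0, zero_smul]

/-- A symmetry permutes the lines freely or trivially, because its action is given by an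
automorphism of the field. -/
theorem perm_apply_ne (F : EigenFrame l K) {G : GL (Fin n) ℤ} {π : Equiv.Perm (Fin n)}
    (h : ∀ i, realOp G (F.b i) ∈ l (π i)) (hπ : π ≠ 1) (i : Fin n) : π i ≠ i := by
  obtain ⟨τ, μ, -, hτ⟩ := F.exists_algHom (h 0)
  have hsh := F.shift_eq_of_mem hτ h
  intro hi
  refine hπ (Equiv.ext fun k => ?_)
  rw [← hsh, F.shift_eq_self (F.eq_id_of_shift_eq ((hsh i).trans hi))]
  rfl

theorem not_isDirichlet_iff (F : EigenFrame l K) {G : GL (Fin n) ℤ} {π : Equiv.Perm (Fin n)}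
    (h : ∀ i, realOp G (F.b i) ∈ l (π i)) : (¬ ∀ i, (l i).map (realOp G) = l i) ↔ π ≠ 1 := by
  rw [not_iff_not]
  have hne : ∀ i, ∃ c : ℝ, c ≠ 0 ∧ realOp G (F.b i) = c • F.b (π i) := fun i => by
    have := h i
    rw [F.line_eq, Submodule.mem_span_singleton] at this
    obtain ⟨c, hc⟩ := this
    refine ⟨c, ?_, hc.symm⟩
    rintro rfl
    exact F.realOp_b_ne_zero G i (by rw [← hc, zero_smul])
  constructor
  · intro hl
    refine Equiv.ext fun i => ?_
    obtain ⟨c, hc, hci⟩ := hne i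
    refine F.eq_of_mem_line hc ?_
    rw [← hci, Equiv.Perm.one_apply, ← hl i]
    exact Submodule.mem_map_of_mem (F.line_eq i ▸ Submodule.mem_span_singleton_self _)
  · rintro rfl i
    obtain ⟨c, hc, hci⟩ := hne i
    rw [F.line_eq, Submodule.map_span, Set.image_singleton, hci, Equiv.Perm.one_apply,
      Submodule.span_singleton_smul_eq (IsUnit.mk0 c hc)]

theorem trace_eq_zero (F : EigenFrame l K) {G : GL (Fin n) ℤ} {π : Equiv.Perm (Fin n)}
    (h : ∀ i, realOp G (F.b i) ∈ l (π i)) (hπ : ∀ i, π i ≠ i) :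
    (G : Matrix (Fin n) (Fin n) ℤ).trace = 0 := by
  have h1 : LinearMap.trace ℝ _ (realOp G) = 0 := by
    rw [LinearMap.trace_eq_matrix_trace ℝ F.b, Matrix.trace]
    refine Finset.sum_eq_zero fun i _ => ?_
    rw [Matrix.diag_apply, LinearMap.toMatrix_apply]
    have := h i
    rw [F.line_eq, Submodule.mem_span_singleton] at this
    obtain ⟨c, hc⟩ := this
    simp [← hc, hπ i]
  rw [realOp, Matrix.trace_toLin'_eq] at h1
  have h2 : ((G : Matrix (Fin n) (Fin n) ℤ).trace : ℝ) = 0 := by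
    rw [← h1]
    simp [Matrix.trace]
  exact_mod_cast h2

/-- An operator preserving every line and fixing a point off the coordinate hyperplanes is the
identity. -/
theorem eq_one_of_fixed (F : EigenFrame l K) {G : GL (Fin n) ℤ}
    (h : ∀ i, realOp G (F.b i) ∈ l i) {x : Fin n → ℝ} (hx : ∀ i, F.b.repr x i ≠ 0)
    (hGx : realOp G x = x) : G = 1 := by
  have : ∀ i, ∃ c : ℝ, c • F.b i = realOp G (F.b i) := fun i => by
    have := h i
    rwa [F.line_eq, Submodule.mem_span_singleton] at this
  choose c hc using this
  have h1 : ∀ i, F.b.repr (realOp G x) i = F.b.repr x i * c i := fun i => by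
    conv_lhs => rw [← F.b.sum_repr x]
    rw [map_sum]
    simp only [map_smul (realOp G), ← hc, smul_smul]
    exact congrFun (F.b.repr_sum_self fun i => F.b.repr x i * c i) i
  apply realOp_injective
  refine F.b.ext fun i => ?_
  have h2 := h1 i
  rw [hGx] at h2
  have h3 : c i = 1 := mul_left_cancel₀ (hx i) (by rw [← h2, mul_one])
  rw [← hc, h3, one_smul, realOp_one]

/-- An involution permuting the lines without fixed lines fixes a point of some sail: no coordinate
vanishes identically on its space of fixed vectors, and a generic fixed vector lies on a ray through a sail. -/
theorem exists_fixed_mem_sail (F : EigenFrame l K) {G : GL (Fin n) ℤ} (hG : G * G = 1)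
    {π : Equiv.Perm (Fin n)} (h : ∀ i, realOp G (F.b i) ∈ l (π i)) (hπ : ∀ i, π i ≠ i) :
    ∃ C ∈ cones l, ∃ x ∈ sail C, realOp G x = x := by
  obtain ⟨x, hGx, hx⟩ : ∃ x, realOp G x = x ∧ ∀ i, F.b.repr x i ≠ 0 := by
    by_contra! hcon
    let V := LinearMap.ker (realOp G - LinearMap.id)
    have hV : ∀ x, x ∈ V ↔ realOp G x = x := fun x => by
      rw [LinearMap.mem_ker, LinearMap.sub_apply, sub_eq_zero, LinearMap.id_apply]
    have hcov : ⋃ i, ((LinearMap.ker (F.b.coord i ∘ₗ V.subtype) : Submodule ℝ V) : Set V) =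
        Set.univ := by
      refine Set.eq_univ_of_forall fun x => ?_
      obtain ⟨i, hi⟩ := hcon x ((hV _).1 x.2)
      exact Set.mem_iUnion.2 ⟨i, hi⟩
    obtain ⟨i, hi⟩ := Subspace.exists_eq_top_of_iUnion_eq_univ hcov
    have hmem : F.b i + realOp G (F.b i) ∈ V := by
      rw [hV, map_add, ← realOp_mul, hG, realOp_one, add_comm]
    have h1 : (⟨_, hmem⟩ : V) ∈ LinearMap.ker (F.b.coord i ∘ₗ V.subtype) := by rw [hi]; trivial
    have h2 : F.b.repr (F.b i + realOp G (F.b i)) i = 0 := h1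
    have h3 := h i
    rw [F.line_eq, Submodule.mem_span_singleton] at h3
    obtain ⟨c, hc⟩ := h3
    rw [← hc] at h2
    simp [hπ i] at h2
  obtain ⟨s, -, hs⟩ := exists_smul_mem_sail F.b F.δ_pos F.le_normForm
    (a := fun i => F.b.repr x i) fun i => mul_self_pos.2 (hx i)
  exact ⟨_, (mem_cones_iff F.b F.line_eq).2 ⟨_, hx, rfl⟩, _, hs, by rw [map_smul, hGx]⟩

end EigenFrame

end Galois

/-! ### Proper palindromic symmetries and involutions -/

section Palindromic

variable {l : Fin 4 → Submodule ℝ (Fin 4 → ℝ)} {K : IntermediateField ℚ ℝ}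

/-- A proper palindromic symmetry or its square is an involution acting on the lines without fixed
lines: a free permutation of four lines has order two or four, and a power of the symmetry that
preserves each line is the identity because of the fixed point. -/
theorem IsProperPalindromicSymmetry.exists_involution (F : EigenFrame l K) {G : GL (Fin 4) ℤ}
    (hG : IsProperPalindromicSymmetry l G) :
    ∃ (H : GL (Fin 4) ℤ) (π : Equiv.Perm (Fin 4)), H * H = 1 ∧ (∀ i, π i ≠ i) ∧
      (∀ i, π (π i) = i) ∧ ∀ i, realOp H (F.b i) ∈ l (π i) := by
  obtain ⟨⟨hsym, hnot⟩, C, hC, x, hx, hGx⟩ := hG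
  have hxne := repr_ne_zero_of_mem_sail F.b F.line_eq F.δ_pos F.le_normForm hC hx
  obtain ⟨π, hπ⟩ := hsym.exists_perm F.b F.line_eq F.δ_pos F.le_normForm
  have hπ1 : π ≠ 1 := (F.not_isDirichlet_iff hπ).1 fun h => hnot ⟨hsym, h⟩
  have hcomp : ∀ {H : GL (Fin 4) ℤ} {ρ : Equiv.Perm (Fin 4)},
      (∀ i, realOp H (F.b i) ∈ l (ρ i)) → ∀ i, realOp (H * H) (F.b i) ∈ l (ρ (ρ i)) := by
    intro H ρ hρ i
    have h1 := hρ i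
    rw [F.line_eq, Submodule.mem_span_singleton] at h1
    obtain ⟨c, hc⟩ := h1
    rw [realOp_mul, ← hc, map_smul]
    exact Submodule.smul_mem _ _ (hρ _)
  have hfree := F.perm_apply_ne hπ hπ1
  by_cases h2 : ∀ i, π (π i) = i
  · refine ⟨G, π, ?_, hfree, h2, hπ⟩
    refine F.eq_one_of_fixed (fun i => ?_) hxne (by rw [realOp_mul, hGx, hGx])
    simpa [h2] using hcomp hπ i
  -- a free permutation of four points whose square is not the identity is a four-cycle
  · have h4 : ∀ π : Equiv.Perm (Fin 4), (∀ i, π i ≠ i) → ∀ i, π (π (π (π i))) = i := by decide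
    have hsq : ∀ i, realOp (G * G) (F.b i) ∈ l ((π * π) i) := hcomp hπ
    refine ⟨G * G, π * π, ?_, F.perm_apply_ne hsq ?_, h4 π hfree, hsq⟩
    · refine F.eq_one_of_fixed (fun i => ?_) hxne (by simp only [realOp_mul, hGx])
      have := hcomp hsq i
      rwa [show (π * π) ((π * π) i) = i from h4 π hfree i] at this
    · exact fun h => h2 fun i => congrArg (fun ρ : Equiv.Perm (Fin 4) => ρ i) h

/-- A nontrivial involution `τ` of the field that acts on a lattice basis proportional to the
eigenvector by an integer matrix gives a proper palindromic symmetry. -/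
theorem EigenFrame.exists_isProperPalindromicSymmetry (F : EigenFrame l K) {τ : K →ₐ[ℚ] K}
    (hτ : ∀ x, τ (τ x) = x) (hτ1 : ∃ x, τ x ≠ x) {w : Fin 4 → K} (hw0 : w 0 = 1)
    {T : Matrix (Fin 4) (Fin 4) ℤ} (hT : T * T = 1) (hw : ∀ i, τ (w i) = intMulVec T w i)
    {v' w' : Fin 4 → ℝ} (hv' : ∀ i, (F.v i : ℝ) = v' i) (hw' : ∀ i, (w i : ℝ) = w' i)
    (hX : IntEquivalent v' w') :
    ∃ G : GL (Fin 4) ℤ, IsProperPalindromicSymmetry l G := by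
  obtain ⟨X, m, hm, hXm⟩ := hX
  set u := intMulVec (X : Matrix (Fin 4) (Fin 4) ℤ) F.v
  have hu : ∀ i, (u i : ℝ) = m * w i := fun i => by
    have h1 := congrFun hXm i
    rw [realOp_eq_intMulVec, ← funext hv', Pi.smul_apply, smul_eq_mul, ← hw'] at h1
    rw [← h1]
    exact map_intMulVec K.val _ F.v i
  have hm0 : m = u 0 := by rw [hu, hw0]; simp
  have hu' : u = fun i => u 0 * w i := funext fun i => Subtype.ext (by
    rw [hu i, hm0]; rfl)
  have hu0 : u 0 ≠ 0 := fun h => hm (by rw [hm0, h]; rfl)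
  let T' : GL (Fin 4) ℤ := ⟨T, T, hT, hT⟩
  let G : GL (Fin 4) ℤ := X⁻¹ * T' * X
  have hGG : G * G = 1 := by
    have : T' * T' = 1 := Units.ext hT
    calc G * G = X⁻¹ * (T' * T') * X := by simp only [G]; group
      _ = 1 := by rw [this]; group
  have hτw : intMulVec T u = fun i => u 0 * τ (w i) := by
    conv_lhs => rw [hu']
    rw [intMulVec_const_mul]
    exact funext fun i => by rw [hw]
  have hτu0 : τ (u 0) ≠ 0 := (map_ne_zero τ).2 hu0
  have hGv : ∀ j, intMulVec (G : Matrix (Fin 4) (Fin 4) ℤ) F.v j =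
      (u 0 / τ (u 0)) * τ (F.v j) := by
    have h1 : intMulVec (G : Matrix (Fin 4) (Fin 4) ℤ) F.v =
        intMulVec (X⁻¹ : GL (Fin 4) ℤ).val (intMulVec T u) := by
      rw [← intMulVec_mul, ← intMulVec_mul]
      rfl
    have h2 : (fun i => u 0 * τ (w i)) = fun i => (u 0 / τ (u 0)) * τ (u i) := by
      ext1 i
      rw [congrFun hu' i, map_mul]
      field_simp
    have h3 : (fun i => τ (u i)) =
        intMulVec (X : Matrix (Fin 4) (Fin 4) ℤ) (fun j => τ (F.v j)) :=
      funext fun i => map_intMulVec τ _ _ i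
    intro j
    rw [h1, hτw, h2, intMulVec_const_mul, h3, ← intMulVec_mul, ← Units.val_mul, inv_mul_cancel,
      Units.val_one, intMulVec_one]
  have hinv := F.shift_involutive hτ
  have hmem : ∀ i, realOp G (F.b i) ∈ l (Function.Involutive.toPerm _ hinv i) := F.realOp_b_mem hGv
  have hfree : ∀ i, Function.Involutive.toPerm _ hinv i ≠ i := fun i hi => by
    obtain ⟨x, hx⟩ := hτ1
    exact hx (F.eq_id_of_shift_eq (i := i) hi x)
  refine ⟨G, ⟨isSymmetry_of_permutes F.b F.line_eq G _ hmem, fun h => ?_⟩,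
    F.exists_fixed_mem_sail hGG hmem hfree⟩
  refine (F.not_isDirichlet_iff hmem).2 (fun h1 => hfree 0 ?_) h.2
  rw [h1]
  rfl

end Palindromic

/-! ### Lattices invariant under an automorphism of the field -/

section Lattice

/-- In a quartic field, an element `x` moved by an involution `τ` has degree four unless its trace
`x + τ x` is rational. -/
theorem natDegree_minpoly_eq_four {K : Type*} [Field K] [Algebra ℚ K]
    (hK : Module.finrank ℚ K = 4) (τ : K →ₐ[ℚ] K) {x : K} (h1 : τ x ≠ x)
    (h2 : ∀ q : ℚ, x + τ x ≠ algebraMap ℚ K q) : (minpoly ℚ x).natDegree = 4 := by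
  have : FiniteDimensional ℚ K := Module.finite_of_finrank_pos (by rw [hK]; norm_num)
  have hint : IsIntegral ℚ x := Algebra.IsIntegral.isIntegral x
  have hdvd : (minpoly ℚ x).natDegree ∣ 4 := hK ▸ minpoly.degree_dvd hint
  have hone : (minpoly ℚ x).natDegree ≠ 1 := fun h => by
    obtain ⟨q, rfl⟩ := minpoly.natDegree_eq_one_iff.1 h
    exact h1 (τ.commutes q)
  have htwo : (minpoly ℚ x).natDegree ≠ 2 := fun h => by
    have hroot : ∀ y : K, Polynomial.aeval y (minpoly ℚ x) =
        algebraMap ℚ K ((minpoly ℚ x).coeff 0) + algebraMap ℚ K ((minpoly ℚ x).coeff 1) * y +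
          y ^ 2 := fun y => by
      have hlead : (minpoly ℚ x).coeff 2 = 1 := h ▸ (minpoly.monic hint).coeff_natDegree
      rw [Polynomial.aeval_eq_sum_range, h]
      simp [Finset.sum_range_succ, hlead, Algebra.smul_def]
    have e1 := hroot x
    have e2 := hroot (τ x)
    rw [minpoly.aeval] at e1
    rw [Polynomial.aeval_algHom_apply, minpoly.aeval, map_zero] at e2
    refine h2 (-(minpoly ℚ x).coeff 1) ?_
    have : (x - τ x) * (x + τ x + algebraMap ℚ K ((minpoly ℚ x).coeff 1)) = 0 := by
      linear_combination e2 - e1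
    rw [map_neg]
    exact eq_neg_of_add_eq_zero_left
      ((mul_eq_zero.1 this).resolve_left (sub_ne_zero.2 (Ne.symm h1)))
  have hle := Nat.le_of_dvd (by norm_num) hdvd
  interval_cases h : (minpoly ℚ x).natDegree <;> simp_all

variable {l : Fin 4 → Submodule ℝ (Fin 4 → ℝ)} {K : IntermediateField ℚ ℝ}

theorem EigenFrame.finrank_eq (F : EigenFrame l K) : Module.finrank ℚ K = 4 := by
  rw [Module.finrank_eq_card_basis F.v, Fintype.card_fin]

/-- When `H v = μ τ(v)` and `H` is conjugate to a matrix `N` with first row `(1, 0, 0, 0)`, the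
lattice spanned by the coordinates of `v` is proportional to one with a basis `u` on which `τ` acts
by `N`: the factor is a vector `a` of the lattice with `μ τ(a) = a`. -/
theorem EigenFrame.exists_basis_of_intConj (F : EigenFrame l K) {H : GL (Fin 4) ℤ}
    {τ : K →ₐ[ℚ] K} {μ : K}
    (h : ∀ k, intMulVec (H : Matrix (Fin 4) (Fin 4) ℤ) F.v k = μ * τ (F.v k))
    {N : Matrix (Fin 4) (Fin 4) ℤ} (hN : N 0 = ![1, 0, 0, 0])
    (hconj : IntConj (H : Matrix (Fin 4) (Fin 4) ℤ) N) :
    ∃ u : Fin 4 → K, u 0 = 1 ∧ LinearIndependent ℚ u ∧ (∀ i, τ (u i) = intMulVec N u i) ∧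
      IntEquivalent (fun i => (F.v i : ℝ)) (fun i => (u i : ℝ)) := by
  obtain ⟨X, hX⟩ := hconj
  set a := intMulVec (X : Matrix (Fin 4) (Fin 4) ℤ) F.v with ha_def
  have ha : LinearIndependent ℚ a := by
    rw [Fintype.linearIndependent_iff]
    intro q hq
    have hdet : ((X : Matrix (Fin 4) (Fin 4) ℤ).map (Int.castRingHom ℚ)).det ≠ 0 := by
      rw [← RingHom.mapMatrix_apply, ← RingHom.map_det, eq_intCast, Int.cast_ne_zero]
      exact ((Matrix.isUnit_iff_isUnit_det _).1 X.isUnit).ne_zero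
    have hv := Fintype.linearIndependent_iff.1 F.v.linearIndependent
      (Matrix.vecMul q ((X : Matrix (Fin 4) (Fin 4) ℤ).map (Int.castRingHom ℚ))) (by
        rw [← hq]
        simp only [Matrix.vecMul, dotProduct, a, intMulVec, Finset.sum_smul, Finset.smul_sum]
        rw [Finset.sum_comm]
        refine Finset.sum_congr rfl fun i _ => Finset.sum_congr rfl fun j _ => ?_
        simp [Algebra.smul_def, mul_assoc])
    exact congrFun (Matrix.eq_zero_of_vecMul_eq_zero hdet (funext hv))
  have hμ : ∀ i, μ * τ (a i) = intMulVec N a i := by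
    intro i
    have h1 : τ (a i) = intMulVec (X : Matrix (Fin 4) (Fin 4) ℤ) (fun k => τ (F.v k)) i :=
      map_intMulVec τ _ _ i
    rw [h1, ← congrFun (intMulVec_const_mul _ μ _) i, ← funext h, ← intMulVec_mul, hX,
      intMulVec_mul]
  have ha0 : a 0 ≠ 0 := ha.ne_zero 0
  have hμ0 : μ * τ (a 0) = a 0 := by
    rw [hμ]
    simp [intMulVec, hN, Fin.sum_univ_four]
  have hau : a = fun i => a 0 * (a i / a 0) := funext fun i => (mul_div_cancel₀ _ ha0).symm
  refine ⟨fun i => a i / a 0, div_self ha0, ?_, fun i => ?_, X, a 0, ?_, ?_⟩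
  · have : (fun i => a i / a 0) = (LinearMap.mulLeft ℚ (a 0)⁻¹) ∘ a :=
      funext fun i => by simp [div_eq_inv_mul]
    rw [this]
    refine ha.map' _ (LinearMap.ker_eq_bot.2 fun x y hxy => ?_)
    exact mul_left_cancel₀ (inv_ne_zero ha0) hxy
  · have hμne : μ ≠ 0 := fun h0 => ha0 (by rw [← hμ0, h0, zero_mul])
    have h1 := hμ i
    rw [hau, intMulVec_const_mul, ← hau] at h1
    rw [map_div₀, ← mul_div_mul_left _ _ hμne, hμ0, h1, mul_div_cancel_left₀ _ ha0]
  · exact fun h0 => ha0 (Subtype.ext h0)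
  · ext i
    rw [realOp_eq_intMulVec, Pi.smul_apply, smul_eq_mul]
    have h1 := (map_intMulVec K.val (X : Matrix (Fin 4) (Fin 4) ℤ) F.v i).symm
    have h2 := congrArg K.val (congrFun hau i)
    rw [map_mul] at h2
    exact h1.trans h2

variable {τ : K →ₐ[ℚ] K} {u : Fin 4 → K}

theorem eq_zero_of_sum_four_eq_zero (hu0 : u 0 = 1) (hu : LinearIndependent ℚ u) {a b c d : ℚ}
    (h : (a : K) + b * u 1 + c * u 2 + d * u 3 = 0) : a = 0 ∧ b = 0 ∧ c = 0 ∧ d = 0 := by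
  have h1 := Fintype.linearIndependent_iff.1 hu ![a, b, c, d] (by
    simp only [Fin.sum_univ_four, Algebra.smul_def, hu0]
    simpa using h)
  exact ⟨h1 0, h1 1, h1 2, h1 3⟩

theorem natDegree_eq_four_of_swapMatrix (hK : Module.finrank ℚ K = 4) (hu0 : u 0 = 1)
    (hu : LinearIndependent ℚ u) {m : ℤ} (h : ∀ i, τ (u i) = intMulVec (swapMatrix m) u i) :
    τ (u 1) = u 3 ∧ u 2 + τ (u 2) = m - (u 1 + u 3) ∧
      (minpoly ℚ (u 1)).natDegree = 4 ∧ (minpoly ℚ (u 2)).natDegree = 4 := by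
  have h1 : τ (u 1) = u 3 := by
    rw [h]; simp [intMulVec, swapMatrix, Fin.sum_univ_four]
  have h2 : u 2 + τ (u 2) = m - (u 1 + u 3) := by
    rw [h]; simp [intMulVec, swapMatrix, Fin.sum_univ_four, hu0]; ring
  have hind := @eq_zero_of_sum_four_eq_zero K u hu0 hu
  refine ⟨h1, h2, natDegree_minpoly_eq_four hK τ (fun h0 => ?_) fun q hq => ?_,
    natDegree_minpoly_eq_four hK τ (fun h0 => ?_) fun q hq => ?_⟩
  · have := hind (a := 0) (b := 1) (c := 0) (d := -1) (by
      push_cast; linear_combination h1 - h0)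
    simp at this
  · have := hind (a := -q) (b := 1) (c := 0) (d := 1) (by
      rw [eq_ratCast] at hq; push_cast; linear_combination hq - h1)
    simp at this
  · have := hind (a := -m) (b := 1) (c := 2) (d := 1) (by
      push_cast; linear_combination h2 - h0)
    simp at this
  · have := hind (a := m - q) (b := -1) (c := 0) (d := -1) (by
      rw [eq_ratCast] at hq; push_cast; linear_combination hq - h2)
    simp at this

theorem natDegree_eq_four_of_reflMatrix (hK : Module.finrank ℚ K = 4) (hu0 : u 0 = 1)
    (hu : LinearIndependent ℚ u) (h : ∀ i, τ (u i) = intMulVec (reflMatrix 0 0 2) u i) :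
    u 1 + τ (u 1) = 2 * u 3 ∧ u 2 + τ (u 2) = -(2 * u 3) ∧
      (minpoly ℚ (u 1)).natDegree = 4 ∧ (minpoly ℚ (u 2)).natDegree = 4 := by
  have h1 : u 1 + τ (u 1) = 2 * u 3 := by
    rw [h]; simp [intMulVec, reflMatrix, Fin.sum_univ_four]
  have h2 : u 2 + τ (u 2) = -(2 * u 3) := by
    rw [h]; simp [intMulVec, reflMatrix, Fin.sum_univ_four]
  have hind := @eq_zero_of_sum_four_eq_zero K u hu0 hu
  refine ⟨h1, h2, natDegree_minpoly_eq_four hK τ (fun h0 => ?_) fun q hq => ?_,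
    natDegree_minpoly_eq_four hK τ (fun h0 => ?_) fun q hq => ?_⟩
  · have := hind (a := 0) (b := 2) (c := 0) (d := -2) (by
      push_cast; linear_combination h1 - h0)
    simp at this
  · have := hind (a := -q) (b := 0) (c := 0) (d := 2) (by
      rw [eq_ratCast] at hq; push_cast; linear_combination hq - h1)
    simp at this
  · have := hind (a := 0) (b := 0) (c := 2) (d := 2) (by
      push_cast; linear_combination h2 - h0)
    simp at this
  · have := hind (a := -q) (b := 0) (c := 0) (d := -2) (by
      rw [eq_ratCast] at hq; push_cast; linear_combination hq - h2)
    simp at this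

section Converse

variable {v' : Fin 4 → ℝ} {ω ψ : K}

theorem EigenFrame.exists_symmetry_of_swap (F : EigenFrame l K) (hv' : ∀ i, (F.v i : ℝ) = v' i)
    (hτ : ∀ x, τ (τ x) = x) (hτ1 : ∃ x, τ x ≠ x) (m : ℤ)
    (hX : IntEquivalent v' ![1, ω, ψ, τ ω])
    (h : (ψ : ℝ) + τ ψ = m - (ω + τ ω)) :
    ∃ G : GL (Fin 4) ℤ, IsProperPalindromicSymmetry l G := by
  have h' : ψ + τ ψ = m - (ω + τ ω) := Subtype.ext (by push_cast; exact h)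
  refine F.exists_isProperPalindromicSymmetry hτ hτ1 (w := ![1, ω, ψ, τ ω]) rfl
    (swapMatrix_mul_self m) (fun i => ?_) hv' (fun i => ?_) hX
  · fin_cases i <;> simp [intMulVec, swapMatrix, Fin.sum_univ_four, hτ]
    linear_combination h'
  · fin_cases i <;> simp

theorem EigenFrame.exists_symmetry_of_refl (F : EigenFrame l K) (hv' : ∀ i, (F.v i : ℝ) = v' i)
    (hτ : ∀ x, τ (τ x) = x) (hτ1 : ∃ x, τ x ≠ x) (a m k : ℤ) {s' : ℝ}
    (hX : IntEquivalent v' ![1, ω, ψ, s'])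
    (hs : s' = (ω + τ ω + a) / 2) (h : (ψ : ℝ) + τ ψ = m - k * s') :
    ∃ G : GL (Fin 4) ℤ, IsProperPalindromicSymmetry l G := by
  obtain ⟨s, rfl⟩ : ∃ s : K, (s : ℝ) = s' := ⟨(ω + τ ω + a) / 2, by rw [hs]; push_cast; rfl⟩
  have hs' : s = (ω + τ ω + a) / 2 := Subtype.ext (by push_cast; exact hs)
  have h' : ψ + τ ψ = m - k * s := Subtype.ext (by push_cast; exact h)
  have hτs : τ s = s := by
    rw [hs', map_div₀, map_add, map_add, hτ, map_intCast, map_ofNat]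
    ring
  refine F.exists_isProperPalindromicSymmetry hτ hτ1 (w := ![1, ω, ψ, s]) rfl
    (reflMatrix_mul_self a m k) (fun i => ?_) hv' (fun i => ?_) hX
  · fin_cases i <;> simp [intMulVec, reflMatrix, Fin.sum_univ_four, hτs]
    · rw [hs']; ring
    · linear_combination h'
  · fin_cases i <;> simp

theorem EigenFrame.exists_symmetry_of_shear (F : EigenFrame l K)
    (hv' : ∀ i, (F.v i : ℝ) = v' i) (hτ : ∀ x, τ (τ x) = x) (hτ1 : ∃ x, τ x ≠ x)
    (hX : IntEquivalent v' ![1, ω, ψ, ((τ ω : K) - ω) / 4])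
    (h : (ψ : ℝ) + τ ψ = 2 - (ω + τ ω) / 2) :
    ∃ G : GL (Fin 4) ℤ, IsProperPalindromicSymmetry l G := by
  have h' : ψ + τ ψ = 2 - (ω + τ ω) / 2 := Subtype.ext (by push_cast; exact h)
  have h4 : τ 4 = 4 := map_ofNat τ 4
  refine F.exists_isProperPalindromicSymmetry hτ hτ1 (w := ![1, ω, ψ, (τ ω - ω) / 4]) rfl
    shearMatrix_mul_self (fun i => ?_) hv' (fun i => ?_) hX
  · fin_cases i <;> simp [intMulVec, shearMatrix, Fin.sum_univ_four, hτ, h4]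
    · ring
    · linear_combination h'
    · ring
  · fin_cases i <;> simp
    rfl

end Converse

end Lattice

/-! ### Numbering the embeddings -/

section Numbering

variable {l : Fin 4 → Submodule ℝ (Fin 4 → ℝ)} {K : IntermediateField ℚ ℝ}

/-- An involution with fixed-point-free action on the four lines makes it possible to number the
embeddings of `K` as `id, σ, τ, σ τ`. -/
theorem EigenFrame.exists_numbering (F : EigenFrame l K) {τ : K →ₐ[ℚ] K}
    (hτ : ∀ x, τ (τ x) = x) (hτ1 : ∃ x, τ x ≠ x) :
    ∃ σ : Fin 4 ≃ (K →ₐ[ℚ] ℝ), σ 0 = K.val ∧ (∀ x, σ 2 x = τ x) ∧ ∀ x, σ 3 x = σ 1 (τ x) := by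
  have hinv := F.shift_involutive hτ
  have hdec : ∀ ρ : Equiv.Perm (Fin 4), (∀ i, ρ i ≠ i) → (∀ i, ρ (ρ i) = i) →
      ∃ π : Equiv.Perm (Fin 4), π 0 = 0 ∧ π 2 = ρ 0 ∧ π 3 = ρ (π 1) := by decide
  obtain ⟨π, h0, h2, h3⟩ := hdec (Function.Involutive.toPerm _ hinv) (fun i hi => by
    obtain ⟨x, hx⟩ := hτ1
    exact hx (F.eq_id_of_shift_eq (i := i) hi x)) hinv
  refine ⟨π.trans F.e, ?_, fun x => ?_, fun x => ?_⟩
  · rw [Equiv.trans_apply, h0, F.e_zero]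
  · rw [Equiv.trans_apply, h2]
    exact (F.e_shift τ 0 x).trans (by rw [F.e_zero]; rfl)
  · rw [Equiv.trans_apply, h3]
    exact F.e_shift τ (π 1) x

/-- A proper palindromic symmetry yields an involution of the field and a basis of a lattice
proportional to that of the eigenvector on which this involution acts in a normal form. -/
theorem EigenFrame.exists_algHom_of_symmetry (F : EigenFrame l K) {G : GL (Fin 4) ℤ}
    (hG : IsProperPalindromicSymmetry l G) :
    ∃ τ : K →ₐ[ℚ] K, (∀ x, τ (τ x) = x) ∧ (∃ x, τ x ≠ x) ∧
      ∃ N : Matrix (Fin 4) (Fin 4) ℤ,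
        (N = swapMatrix 0 ∨ N = swapMatrix 1 ∨ N = reflMatrix 0 0 2) ∧
        ∃ u : Fin 4 → K, u 0 = 1 ∧ LinearIndependent ℚ u ∧ (∀ i, τ (u i) = intMulVec N u i) ∧
          IntEquivalent (fun i => (F.v i : ℝ)) (fun i => (u i : ℝ)) := by
  obtain ⟨H, π, hH, hfree, hπ, hmem⟩ := hG.exists_involution F
  obtain ⟨τ, μ, -, hτ⟩ := F.exists_algHom (hmem 0)
  have hsh := F.shift_eq_of_mem hτ hmem
  refine ⟨τ, fun x => ?_, ?_, ?_⟩
  · apply (F.e 0).injective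
    change F.e 0 (τ (τ x)) = F.e 0 x
    rw [← F.e_shift, ← F.e_shift, hsh, hsh, hπ]
  · by_contra! h
    exact hfree 0 ((hsh 0).symm.trans (F.shift_eq_self h 0))
  · obtain ⟨N, hN, hconj⟩ : ∃ N, (N = swapMatrix 0 ∨ N = swapMatrix 1 ∨ N = reflMatrix 0 0 2) ∧
        IntConj (H : Matrix (Fin 4) (Fin 4) ℤ) N := by
      rcases intConj_of_involution (congrArg Units.val hH) (F.trace_eq_zero hmem hfree)
        with h | h | h
      exacts [⟨_, Or.inl rfl, h⟩, ⟨_, Or.inr (Or.inl rfl), h⟩, ⟨_, Or.inr (Or.inr rfl), h⟩]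
    refine ⟨N, hN, F.exists_basis_of_intConj hτ ?_ hconj⟩
    rcases hN with rfl | rfl | rfl <;> rfl

theorem exists_eigenFrame_of_adjoin {l : Fin 4 → Submodule ℝ (Fin 4 → ℝ)}
    (hl : IsAlgebraic l) {α β γ : ℝ} (hl₁ : l 0 = Submodule.span ℝ {![1, α, β, γ]})
    {K : IntermediateField ℚ ℝ} (hK : K = IntermediateField.adjoin ℚ {α, β, γ}) :
    ∃ F : EigenFrame l K, ∀ j, (F.v j : ℝ) = ![1, α, β, γ] j := by
  refine hl.nonempty_eigenFrame rfl hl₁ (hK.trans (le_antisymm ?_ ?_))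
  · refine IntermediateField.adjoin.mono _ _ _ ?_
    rintro _ (rfl | rfl | rfl)
    exacts [⟨1, rfl⟩, ⟨2, rfl⟩, ⟨3, rfl⟩]
  · rw [IntermediateField.adjoin_le_iff]
    rintro _ ⟨j, rfl⟩
    fin_cases j
    · exact one_mem _
    all_goals exact IntermediateField.subset_adjoin _ _ (by simp)

end Numbering

end KleinPolyhedra

/-- The embeddings `σ₁ = id, σ₂, σ₃, σ₄` are `σ 0, σ 1, σ 2, σ 3`. -/
theorem theorem3 (l : Fin 4 → Submodule ℝ (Fin 4 → ℝ)) (hl : KleinPolyhedra.IsAlgebraic l)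
    (α β γ : ℝ) (hl₁ : l 0 = Submodule.span ℝ {![1, α, β, γ]})
    (K : IntermediateField ℚ ℝ) (hK : K = IntermediateField.adjoin ℚ {α, β, γ}) :
    (∃ G : GL (Fin 4) ℤ, KleinPolyhedra.IsProperPalindromicSymmetry l G) ↔
      ∃ σ : Fin 4 ≃ (K →ₐ[ℚ] ℝ), σ 0 = K.val ∧
        (σ 2).fieldRange = K ∧ (σ 3).fieldRange = (σ 1).fieldRange ∧
        (∃ h : ∀ x : K, σ 2 x ∈ K,
          (∀ x : K, σ 2 ⟨σ 2 x, h x⟩ = x) ∧ (∀ x : K, σ 3 x = σ 1 ⟨σ 2 x, h x⟩)) ∧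
        ∃ ω ψ : K, (minpoly ℚ ω).natDegree = 4 ∧ (minpoly ℚ ψ).natDegree = 4 ∧
          ∃ ω' ψ' : ℝ, ω' = σ 2 ω ∧ ψ' = σ 2 ψ ∧
          ((KleinPolyhedra.IntEquivalent ![1, α, β, γ] ![1, ω, ψ, ω'] ∧
              ψ + ψ' = -(ω + ω')) ∨
           (KleinPolyhedra.IntEquivalent ![1, α, β, γ] ![1, ω, ψ, ω'] ∧
              ψ + ψ' = 1 - (ω + ω')) ∨
           (KleinPolyhedra.IntEquivalent ![1, α, β, γ] ![1, ω, ψ, ω'] ∧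
              ψ + ψ' = 2 - (ω + ω')) ∨
           (KleinPolyhedra.IntEquivalent ![1, α, β, γ] ![1, ω, ψ, (ω + ω') / 2] ∧
              ψ + ψ' = -(ω + ω')) ∨
           (KleinPolyhedra.IntEquivalent ![1, α, β, γ] ![1, ω, ψ, (ω + ω') / 2] ∧
              ψ + ψ' = 2 - (ω + ω')) ∨
           (KleinPolyhedra.IntEquivalent ![1, α, β, γ] ![1, ω, ψ, (ω + ω' + 1) / 2] ∧
              ψ + ψ' = -(ω + ω')) ∨
           (KleinPolyhedra.IntEquivalent ![1, α, β, γ] ![1, ω, ψ, (ω + ω' + 1) / 2] ∧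
              ψ + ψ' = 2 - (ω + ω')) ∨
           (KleinPolyhedra.IntEquivalent ![1, α, β, γ] ![1, ω, ψ, (ω + ω') / 2] ∧
              ψ + ψ' = 1 - (ω + ω') / 2) ∨
           (KleinPolyhedra.IntEquivalent ![1, α, β, γ] ![1, ω, ψ, (ω + ω') / 2] ∧
              ψ + ψ' = 2 - (ω + ω') / 2) ∨
           (KleinPolyhedra.IntEquivalent ![1, α, β, γ] ![1, ω, ψ, (ω' - ω) / 4] ∧
              ψ + ψ' = 2 - (ω + ω') / 2)) := by
  obtain ⟨F, hF⟩ := KleinPolyhedra.exists_eigenFrame_of_adjoin hl hl₁ hK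
  constructor
  · rintro ⟨G, hG⟩
    obtain ⟨τ, hτ, hτ1, N, hN, u, hu0, hu, hτu, hX⟩ := F.exists_algHom_of_symmetry hG
    obtain ⟨σ, h0, h2, h3⟩ := F.exists_numbering hτ hτ1
    have hmem : ∀ x : K, σ 2 x ∈ K := fun x => by rw [h2]; exact (τ x).2
    have hval : ∀ x : K, (⟨σ 2 x, hmem x⟩ : K) = τ x := fun x => Subtype.ext (h2 x)
    refine ⟨σ, h0, ?_, ?_, ⟨hmem, fun x => ?_, fun x => ?_⟩, u 1, u 2, ?_⟩
    · ext y
      constructor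
      · rintro ⟨x, rfl⟩
        exact hmem x
      · intro hy
        exact ⟨τ ⟨y, hy⟩, (h2 _).trans (by rw [hτ])⟩
    · ext y
      constructor
      · rintro ⟨x, rfl⟩
        exact ⟨τ x, (h3 x).symm⟩
      · rintro ⟨x, rfl⟩
        exact ⟨τ x, (h3 _).trans (by rw [hτ]; rfl)⟩
    · rw [hval, h2, hτ]
    · rw [hval, h3]
    · rw [funext hF] at hX
      have hvec : (fun i => (u i : ℝ)) = ![1, (u 1 : ℝ), u 2, u 3] := by
        ext i
        fin_cases i <;> simp [hu0]
      rw [hvec] at hX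
      rcases hN with rfl | rfl | rfl
      · obtain ⟨h13, hrel, d1, d2⟩ :=
          KleinPolyhedra.natDegree_eq_four_of_swapMatrix F.finrank_eq hu0 hu hτu
        refine ⟨d1, d2, _, _, rfl, rfl, Or.inl ⟨?_, ?_⟩⟩
        · rwa [h2, h13]
        · rw [h2, h2, h13]
          have := congrArg K.val hrel
          push_cast at this
          simpa using this
      · obtain ⟨h13, hrel, d1, d2⟩ :=
          KleinPolyhedra.natDegree_eq_four_of_swapMatrix F.finrank_eq hu0 hu hτu
        refine ⟨d1, d2, _, _, rfl, rfl, Or.inr (Or.inl ⟨?_, ?_⟩)⟩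
        · rwa [h2, h13]
        · rw [h2, h2, h13]
          have := congrArg K.val hrel
          push_cast at this
          simpa using this
      · obtain ⟨h13, hrel, d1, d2⟩ :=
          KleinPolyhedra.natDegree_eq_four_of_reflMatrix F.finrank_eq hu0 hu hτu
        have e1 : (u 1 : ℝ) + τ (u 1) = 2 * u 3 := congrArg K.val h13
        have e2 : (u 2 : ℝ) + τ (u 2) = -(2 * u 3) := congrArg K.val hrel
        refine ⟨d1, d2, _, _, rfl, rfl, Or.inr (Or.inr (Or.inr (Or.inl ⟨?_, ?_⟩)))⟩
        · rwa [h2, e1, mul_div_cancel_left₀ _ (two_ne_zero' ℝ)]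
        · rw [h2, h2, e1, e2]
  · rintro ⟨σ, h0, -, -, ⟨hmem, hinv, -⟩, ω, ψ, -, -, _, _, rfl, rfl, hcases⟩
    let τ : K →ₐ[ℚ] K := AlgHom.codRestrict (σ 2) K.toSubalgebra hmem
    have hτ : ∀ x, τ (τ x) = x := fun x => Subtype.ext (hinv x)
    have hτ1 : ∃ x, τ x ≠ x := by
      by_contra! h
      have h20 : σ 2 = σ 0 := by
        rw [h0]
        exact AlgHom.ext fun x => congrArg Subtype.val (h x)
      exact absurd (σ.injective h20) (by decide)
    have hσ : ∀ x, σ 2 x = τ x := fun x => rfl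
    simp only [hσ] at hcases
    rcases hcases with ⟨hX, h⟩ | ⟨hX, h⟩ | ⟨hX, h⟩ | ⟨hX, h⟩ | ⟨hX, h⟩ | ⟨hX, h⟩ | ⟨hX, h⟩ |
      ⟨hX, h⟩ | ⟨hX, h⟩ | ⟨hX, h⟩
    · exact F.exists_symmetry_of_swap hF hτ hτ1 0 hX (by push_cast; linarith)
    · exact F.exists_symmetry_of_swap hF hτ hτ1 1 hX (by push_cast; linarith)
    · exact F.exists_symmetry_of_swap hF hτ hτ1 2 hX (by push_cast; linarith)
    · exact F.exists_symmetry_of_refl hF hτ hτ1 0 0 2 hX (by push_cast; ring) (by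
        push_cast; linarith)
    · exact F.exists_symmetry_of_refl hF hτ hτ1 0 2 2 hX (by push_cast; ring) (by
        push_cast; linarith)
    · exact F.exists_symmetry_of_refl hF hτ hτ1 1 1 2 hX (by push_cast; ring) (by
        push_cast; linarith)
    · exact F.exists_symmetry_of_refl hF hτ hτ1 1 3 2 hX (by push_cast; ring) (by
        push_cast; linarith)
    · exact F.exists_symmetry_of_refl hF hτ hτ1 0 1 1 hX (by push_cast; ring) (by
        push_cast; linarith)
    · exact F.exists_symmetry_of_refl hF hτ hτ1 0 2 1 hX (by push_cast; ring) (by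
        push_cast; linarith)
    · exact F.exists_symmetry_of_shear hF hτ hτ1 hX h
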